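/- \textbf{Kwapień's Factorization Theorem.} Let $1\le p,q\le\infty$ with $\frac1p+\frac1q\le 1$, let $r\in[1,\infty]$ be determined by $1=\frac1r+\frac1p+\frac1q$, and let $r^*$ be the conjugate exponent of $r$. Let $n\ge 1$, let $X_1,\dots,X_n,Y$ be Banach spaces over $\mathbb K=\mathbb R$ or $\mathbb C$, and let $T:X_1\times\dots\times X_n\to Y$ be a multilinear map. Notation. For $x=(x^1,\dots,x^n)$ put $\otimes(x)=x^1\otimes\dots\otimes x^n$; $\pi$ is the projective norm on $X_1\otimes\dots\otimes X_n$. The space $\mathcal L(X_1,\dots,X_n)$ of bounded multilinear forms is identified isometrically with the dual of $(X_1\otimes\dots\otimes X_n,\pi)$ and carries the corresponding weak* topology; $B_E$ is the closed unit ball of $E$. For finite sequences put $$\|(\otimes(x_i)-\otimes(z_i))_i\|_p^{w,\pi}=\sup_{\varphi\in B_{\mathcal L(X_1,\dots,X_n)}}\|(\varphi(x_i)-\varphi(z_i))_i\|_{\ell_p},\qquad \|(v_i)_i\|_q^w=\sup_{f\in B_{E^*}}\|(f(v_i))_i\|_{\ell_q}\quad(v_i\in E).$$ A set $K\subset B_{E^*}$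 is norming if $\|u\|=\sup_{\psi\in K}|\psi(u)|$ for all $u\in E$ (in particular $K\ne\emptyset$); $K\subset B_{\mathcal L(X_1,\dots,X_n)}$ is norming for $E=(X_1\otimes\dots\otimes X_n,\pi)$, and $L\subset B_{Y^{**}}$ is norming for $E=Y^*$. A bounded multilinear map $A:X_1\times\dots\times X_n\to Z$ is Lipschitz $p$-summing if there is $C>0$ with $\|(\|A(x_i)-A(z_i)\|)_i\|_{\ell_p}\le C\|(\otimes(x_i)-\otimes(z_i))_i\|_p^{w,\pi}$ for all finite sequences $(x_i),(z_i)$ in $X_1\times\dots\times X_n$, and $\pi_p^{Lip}(A)$ is the infimum of such $C$. A bounded linear map $u:E\to F$ is $q$-summing if there is $C>0$ with $\|(\|u(v_i)\|)_i\|_{\ell_q}\le C\|(v_i)_i\|_q^w$ for all finite sequences in $E$, and $\pi_q(u)$ is the infimum of such $C$. For a bounded multilinear $A$, write $A(\Sigma)=A(X_1\times\dots\times X_n)\subset Z$, with the metric of $Z$, and let $A(\Sigma)^*$ be the space of Lipschitz functions $\psi:A(\Sigma)\to\mathbb K$ with $\psi\circ A$ multilinear, normed by the least Lipschitz constant. If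 $B:A(\Sigma)\to Y$ is Lipschitz and $B\circ A$ is multilinear, its adjoint is $B^*:Y^*\to A(\Sigma)^*$, $B^*y^*=y^*\circ B$. The following are equivalent: (i) $T$ is $\pi$-$(p,q)$-dominated: there is $C>0$ such that $$\|(\langle y_i^*,T(x_i)-T(z_i)\rangle)_{i=1}^m\|_{\ell_{r^*}}\le C\,\|(\otimes(x_i)-\otimes(z_i))_{i=1}^m\|_p^{w,\pi}\,\|(y_i^*)_{i=1}^m\|_q^w$$ for all finite sequences $(x_i)_{i=1}^m,(z_i)_{i=1}^m$ in $X_1\times\dots\times X_n$ and $(y_i^*)_{i=1}^m$ in $Y^*$. (ii) For all weak*-compact norming sets $K\subset B_{\mathcal L(X_1,\dots,X_n)}$ and $L\subset B_{Y^{**}}$ there are a constant $C>0$ and regular Borel probability measures $\mu$ on $K$ and $\nu$ on $L$ such that $$|\langle y^*,T(x)-T(z)\rangle|\le C\Big(\int_K|\psi(x)-\psi(z)|^p\,d\mu(\psi)\Big)^{1/p}\Big(\int_L|y^{**}(y^*)|^q\,d\nu(y^{**})\Big)^{1/q}$$ for all $x,z\in X_1\times\dots\times X_n$ and $y^*\in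 Y^*$, where the first factor is replaced by $\pi(\otimes(x)-\otimes(z))$ if $p=\infty$ and the second by $\|y^*\|$ if $q=\infty$. (iii) $T=B\circ A$ for some Banach space $Z$, some Lipschitz $p$-summing multilinear map $A:X_1\times\dots\times X_n\to Z$, and some Lipschitz function $B:A(\Sigma)\to Y$ whose adjoint $B^*:Y^*\to A(\Sigma)^*$ is $q$-summing. Let $D_{p,q}^\pi(T)$ denote the infimum of the constants $C$ in (i). If (i)–(iii) hold, then for all $K,L$ as in (ii) the infimum of the constants $C>0$ for which the inequality in (ii) holds with some $\mu,\nu$ equals $D_{p,q}^\pi(T)$, and $$D_{p,q}^\pi(T)=\inf \pi_p^{Lip}(A)\,\pi_q(B^*),$$ where the infimum is over all factorizations as in (iii). -/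

import Mathlib

open MeasureTheory
open scoped ENNReal NNReal TensorProduct

universe u

noncomputable section

namespace Kwapien

/-! ### Norms of finite sequences -/

/-- The `ℓ_s`-norm (`s ∈ [1, ∞]`) of a finite sequence of elements of a seminormed space. -/
def ellNorm {F : Type*} [SeminormedAddCommGroup F] (s : ℝ≥0∞) {m : ℕ} (a : Fin m → F) : ℝ :=
  ‖(WithLp.toLp s a : PiLp s fun _ : Fin m => F)‖

/-- The weak `ℓ_s`-norm of a finite sequence in `E`: the supremum over `f` in the unit ball of the
dual space of the `ℓ_s`-norm of `(f (v i))_i`. -/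
def weakNorm (𝕜 : Type) [RCLike 𝕜] {E : Type*} [SeminormedAddCommGroup E] [NormedSpace 𝕜 E]
    (s : ℝ≥0∞) {m : ℕ} (v : Fin m → E) : ℝ :=
  ⨆ f : {f : StrongDual 𝕜 E // ‖f‖ ≤ 1}, ellNorm s fun i => f.1 (v i)

/-- The exponent `r ∈ [1, ∞]` with `1 = 1/r + 1/p + 1/q` (for `1/p + 1/q ≤ 1`). -/
def rExp (p q : ℝ≥0∞) : ℝ≥0∞ := (1 - (p⁻¹ + q⁻¹))⁻¹

/-- The conjugate exponent `r*` of `r`. -/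
def rStar (p q : ℝ≥0∞) : ℝ≥0∞ := ENNReal.conjExponent (rExp p q)

theorem rExp_spec {p q : ℝ≥0∞} (h : p⁻¹ + q⁻¹ ≤ 1) : 1 = (rExp p q)⁻¹ + p⁻¹ + q⁻¹ := by
  rw [rExp, inv_inv, add_assoc, tsub_add_cancel_of_le h]

theorem rStar_spec (p q : ℝ≥0∞) :
    (rExp p q).HolderConjugate (rStar p q) := by
  refine ENNReal.HolderConjugate.conjExponent ?_
  rw [rExp, ENNReal.one_le_inv]
  exact tsub_le_self

section Multilinear

variable {𝕜 : Type} [RCLike 𝕜] {n : ℕ}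
  {X : Fin n → Type*} [∀ i, NormedAddCommGroup (X i)] [∀ i, NormedSpace 𝕜 (X i)]
  {Y : Type*} [NormedAddCommGroup Y] [NormedSpace 𝕜 Y]
  {Z : Type*} [NormedAddCommGroup Z] [NormedSpace 𝕜 Z]

/-- The weak norm `‖(x_i^1 ⊗ ⋯ ⊗ x_i^n - z_i^1 ⊗ ⋯ ⊗ z_i^n)_i‖_s^{w,π}` : the supremum over `φ` in
the unit ball of the bounded multilinear forms of the `ℓ_s`-norm of `(φ (x_i) - φ (z_i))_i`. -/
def segreWeakNorm (𝕜 : Type) [RCLike 𝕜] {n : ℕ}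
    {X : Fin n → Type*} [∀ i, NormedAddCommGroup (X i)] [∀ i, NormedSpace 𝕜 (X i)]
    (s : ℝ≥0∞) {m : ℕ} (x z : Fin m → ∀ i, X i) : ℝ :=
  ⨆ φ : {φ : ContinuousMultilinearMap 𝕜 X 𝕜 // ‖φ‖ ≤ 1},
    ellNorm s fun j => φ.1 (x j) - φ.1 (z j)

/-! ### `π`-`(p,q)`-dominated multilinear operators -/

/-- The constant `C` satisfies the inequality defining `π`-`(p,q)`-domination of `T`. -/
def DominatedWith (p q : ℝ≥0∞) (T : MultilinearMap 𝕜 X Y) (C : ℝ) : Prop :=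
  ∀ (m : ℕ) (x z : Fin m → ∀ i, X i) (y : Fin m → StrongDual 𝕜 Y),
    ellNorm (rStar p q) (fun j => y j (T (x j) - T (z j))) ≤
      C * segreWeakNorm 𝕜 p x z * weakNorm 𝕜 q y

/-- `T` is `π`-`(p,q)`-dominated. -/
def IsDominated (p q : ℝ≥0∞) (T : MultilinearMap 𝕜 X Y) : Prop :=
  ∃ C : ℝ, 0 < C ∧ DominatedWith p q T C

/-- `D_{p,q}^π(T)`. -/
def dominatedNorm (p q : ℝ≥0∞) (T : MultilinearMap 𝕜 X Y) : ℝ :=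
  sInf {C : ℝ | 0 < C ∧ DominatedWith p q T C}

/-! ### Pietsch-type domination -/

/-- The Borel `σ`-algebra of the weak* topology. -/
instance weakDualMeasurableSpace {E : Type*} [SeminormedAddCommGroup E] [NormedSpace 𝕜 E] :
    MeasurableSpace (WeakDual 𝕜 E) := borel _

instance weakDualBorelSpace {E : Type*} [SeminormedAddCommGroup E] [NormedSpace 𝕜 E] :
    BorelSpace (WeakDual 𝕜 E) := ⟨rfl⟩

/-- `K` is a weak*-compact norming subset of the unit ball of the dual of `E`. (As the empty set
has no supremum in `ℝ`, a norming set is nonempty.) -/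
structure IsCompactNorming {E : Type*} [SeminormedAddCommGroup E] [NormedSpace 𝕜 E]
    (K : Set (WeakDual 𝕜 E)) : Prop where
  isCompact : IsCompact K
  norm_le_one : ∀ ψ ∈ K, ‖WeakDual.toStrongDual ψ‖ ≤ 1
  norming : ∀ u : E, IsLUB ((fun ψ : WeakDual 𝕜 E => ‖ψ u‖) '' K) ‖u‖

/-- `(∫_K |ψ(u)|^s dμ(ψ))^{1/s}`, replaced by `‖u‖` if `s = ∞`. -/
def dualMean {E : Type*} [SeminormedAddCommGroup E] [NormedSpace 𝕜 E] (s : ℝ≥0∞)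
    {K : Set (WeakDual 𝕜 E)} (μ : Measure K) (u : E) : ℝ :=
  if s = ∞ then ‖u‖ else (∫ ψ : K, ‖ψ.1 u‖ ^ s.toReal ∂μ) ^ (1 / s.toReal)

/-- The constant `C` satisfies the Pietsch-type domination inequality for `T` on `K` and `L`, for
some regular Borel probability measures `μ` on `K` and `ν` on `L`.

Here `⨂[𝕜] i, X i` carries Mathlib's norm, the projective norm `π`, and the space of bounded
multilinear forms on `X_1 × ⋯ × X_n` with its weak* topology is the weak* dual of
`⨂[𝕜] i, X i` (via the isometry `PiTensorProduct.liftIsometry`): `ψ` is evaluated at `(x_1, …, x_n)`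
as `ψ (x_1 ⊗ ⋯ ⊗ x_n)`. -/
def DominationOn (p q : ℝ≥0∞) (T : MultilinearMap 𝕜 X Y)
    (K : Set (WeakDual 𝕜 (⨂[𝕜] i, X i))) (L : Set (WeakDual 𝕜 (StrongDual 𝕜 Y))) (C : ℝ) : Prop :=
  ∃ (μ : Measure K) (ν : Measure L),
    IsProbabilityMeasure μ ∧ μ.Regular ∧ IsProbabilityMeasure ν ∧ ν.Regular ∧
    ∀ (x z : ∀ i, X i) (y : StrongDual 𝕜 Y),
      ‖y (T x - T z)‖ ≤
        C * dualMean p μ (PiTensorProduct.tprod 𝕜 x - PiTensorProduct.tprod 𝕜 z) * dualMean q ν y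

/-! ### Summing operators -/

/-- The constant `C` satisfies the inequality defining `q`-summability of the linear map `u`. -/
def SummingWith {E F : Type*} [SeminormedAddCommGroup E] [NormedSpace 𝕜 E]
    [SeminormedAddCommGroup F] [NormedSpace 𝕜 F] (q : ℝ≥0∞) (u : E →L[𝕜] F) (C : ℝ) : Prop :=
  ∀ (m : ℕ) (v : Fin m → E), ellNorm q (fun j => u (v j)) ≤ C * weakNorm 𝕜 q v

/-- The linear operator `u` is (absolutely) `q`-summing. -/
def IsSumming {E F : Type*} [SeminormedAddCommGroup E] [NormedSpace 𝕜 E]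
    [SeminormedAddCommGroup F] [NormedSpace 𝕜 F] (q : ℝ≥0∞) (u : E →L[𝕜] F) : Prop :=
  ∃ C : ℝ, 0 < C ∧ SummingWith q u C

/-- The `q`-summing norm `π_q(u)`. -/
def summingNorm {E F : Type*} [SeminormedAddCommGroup E] [NormedSpace 𝕜 E]
    [SeminormedAddCommGroup F] [NormedSpace 𝕜 F] (q : ℝ≥0∞) (u : E →L[𝕜] F) : ℝ :=
  sInf {C : ℝ | 0 < C ∧ SummingWith q u C}

/-- The constant `C` satisfies the inequality defining Lipschitz `p`-summability of `A`. -/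
def LipSummingWith (p : ℝ≥0∞) (A : ContinuousMultilinearMap 𝕜 X Z) (C : ℝ) : Prop :=
  ∀ (m : ℕ) (x z : Fin m → ∀ i, X i),
    ellNorm p (fun j => A (x j) - A (z j)) ≤ C * segreWeakNorm 𝕜 p x z

/-- The bounded multilinear operator `A` is Lipschitz `p`-summing. -/
def IsLipSumming (p : ℝ≥0∞) (A : ContinuousMultilinearMap 𝕜 X Z) : Prop :=
  ∃ C : ℝ, 0 < C ∧ LipSummingWith p A C

/-- The Lipschitz `p`-summing norm `π_p^{Lip}(A)`. -/
def lipSummingNorm (p : ℝ≥0∞) (A : ContinuousMultilinearMap 𝕜 X Z) : ℝ :=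
  sInf {C : ℝ | 0 < C ∧ LipSummingWith p A C}

/-! ### The dual of the image of a multilinear map, and adjoints -/

/-- The least Lipschitz constant of a Lipschitz map. -/
def lipConst {α β : Type*} [PseudoMetricSpace α] [PseudoMetricSpace β] (f : α → β) : ℝ :=
  sInf {C : ℝ | 0 ≤ C ∧ ∀ a b, dist (f a) (f b) ≤ C * dist a b}

theorem lipConst_nonneg {α β : Type*} [PseudoMetricSpace α] [PseudoMetricSpace β] (f : α → β) :
    0 ≤ lipConst f := Real.sInf_nonneg fun _ h => h.1

theorem lipConst_le {α β : Type*} [PseudoMetricSpace α] [PseudoMetricSpace β] {f : α → β} {C : ℝ}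
    (hC : 0 ≤ C) (h : ∀ a b, dist (f a) (f b) ≤ C * dist a b) : lipConst f ≤ C :=
  csInf_le ⟨0, fun _ h => h.1⟩ ⟨hC, h⟩

theorem dist_le_lipConst {α β : Type*} [PseudoMetricSpace α] [PseudoMetricSpace β] {f : α → β}
    (hf : ∃ C : ℝ≥0, LipschitzWith C f) (a b : α) : dist (f a) (f b) ≤ lipConst f * dist a b := by
  obtain ⟨C, hC⟩ := hf
  rcases (dist_nonneg (x := a) (y := b)).eq_or_lt with h0 | h0
  · have := hC.dist_le_mul a b
    rw [← h0] at this ⊢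
    simpa using this
  · rw [← div_le_iff₀ h0]
    refine le_csInf ⟨C, C.2, hC.dist_le_mul⟩ fun c hc => ?_
    rw [div_le_iff₀ h0]
    exact hc.2 a b

/-- The map `A`, corestricted to its image. -/
def toImage (A : ContinuousMultilinearMap 𝕜 X Z) (x : ∀ i, X i) : Set.range A :=
  ⟨A x, Set.mem_range_self x⟩

/-- `B ∘ A` is multilinear, for a function `B` on the image of `A`. -/
def IsMultilinearComp {W : Type*} [AddCommMonoid W] [Module 𝕜 W]
    (A : ContinuousMultilinearMap 𝕜 X Z) (B : Set.range A → W) : Prop :=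
  ∃ φ : MultilinearMap 𝕜 X W, ∀ x, φ x = B (toImage A x)

/-- The vector space of all Lipschitz functions `ψ` on the image of `A` (with the metric of `Z`)
such that `ψ ∘ A` is multilinear, as a space of functions. -/
def imageDualSubmodule (A : ContinuousMultilinearMap 𝕜 X Z) : Submodule 𝕜 (Set.range A → 𝕜) where
  carrier := {ψ | (∃ C : ℝ≥0, LipschitzWith C ψ) ∧ IsMultilinearComp A ψ}
  add_mem' := by
    rintro f g ⟨⟨C, hC⟩, φ, hφ⟩ ⟨⟨D, hD⟩, χ, hχ⟩
    exact ⟨⟨C + D, hC.add hD⟩, φ + χ, fun x => by simp [hφ, hχ]⟩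
  zero_mem' := ⟨⟨0, LipschitzWith.const 0⟩, 0, fun x => by simp⟩
  smul_mem' := by
    rintro c f ⟨⟨C, hC⟩, φ, hφ⟩
    refine ⟨⟨‖c‖₊ * C, ?_⟩, c • φ, fun x => by simp [hφ]⟩
    refine LipschitzWith.of_dist_le_mul fun a b => ?_
    have := hC.dist_le_mul a b
    simp only [Pi.smul_apply, dist_smul₀, NNReal.coe_mul, coe_nnnorm, mul_assoc]
    gcongr

/-- The space `(f_A(Σ))^*`, to be normed by the Lipschitz norm. -/
def ImageDual (A : ContinuousMultilinearMap 𝕜 X Z) : Type _ := imageDualSubmodule A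

instance (A : ContinuousMultilinearMap 𝕜 X Z) : AddCommGroup (ImageDual A) :=
  inferInstanceAs (AddCommGroup (imageDualSubmodule A))

instance (A : ContinuousMultilinearMap 𝕜 X Z) : Module 𝕜 (ImageDual A) :=
  inferInstanceAs (Module 𝕜 (imageDualSubmodule A))

/-- The Lipschitz norm on `(f_A(Σ))^*`. -/
def imageDualNorm [NeZero n] (A : ContinuousMultilinearMap 𝕜 X Z) : AddGroupNorm (ImageDual A) where
  toFun ψ := lipConst ψ.1
  map_zero' := le_antisymm
    (lipConst_le le_rfl fun a b => by
      have : ((0 : ImageDual A).1 : Set.range A → 𝕜) = 0 := rfl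
      simp [this]) (lipConst_nonneg _)
  add_le' f g := by
    refine lipConst_le (add_nonneg (lipConst_nonneg _) (lipConst_nonneg _)) fun a b => ?_
    have h : ((f + g).1 : Set.range A → 𝕜) = f.1 + g.1 := rfl
    rw [h, add_mul]
    exact (dist_add_add_le _ _ _ _).trans
      (add_le_add (dist_le_lipConst f.2.1 a b) (dist_le_lipConst g.2.1 a b))
  neg' f := by
    have h : ((-f).1 : Set.range A → 𝕜) = -f.1 := rfl
    simp only [lipConst, h, Pi.neg_apply, dist_neg_neg]
  eq_zero_of_map_eq_zero' f hf := by
    obtain ⟨φ, hφ⟩ := f.2.2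
    refine Subtype.ext (funext fun a => ?_)
    have h := dist_le_lipConst f.2.1 a (toImage A 0)
    rw [hf, zero_mul] at h
    have h2 := dist_le_zero.1 h
    rw [h2, ← hφ]
    exact φ.map_coord_zero (0 : Fin n) rfl

instance [NeZero n] (A : ContinuousMultilinearMap 𝕜 X Z) : NormedAddCommGroup (ImageDual A) :=
  (imageDualNorm A).toNormedAddCommGroup

theorem imageDual_norm_def [NeZero n] (A : ContinuousMultilinearMap 𝕜 X Z) (ψ : ImageDual A) :
    ‖ψ‖ = lipConst ψ.1 := rfl

instance [NeZero n] (A : ContinuousMultilinearMap 𝕜 X Z) : NormedSpace 𝕜 (ImageDual A) where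
  norm_smul_le c f := by
    rw [imageDual_norm_def, imageDual_norm_def]
    refine lipConst_le (mul_nonneg (norm_nonneg _) (lipConst_nonneg _)) fun a b => ?_
    have h : ((c • f).1 : Set.range A → 𝕜) = c • f.1 := rfl
    rw [h, Pi.smul_apply, Pi.smul_apply, dist_smul₀, mul_assoc]
    exact mul_le_mul_of_nonneg_left (dist_le_lipConst f.2.1 a b) (norm_nonneg _)

/-- The adjoint `B^* : Y^* → (f_A(Σ))^*`, `y^* ↦ y^* ∘ B`, of a Lipschitz function `B` on the image
of `A` such that `B ∘ A` is multilinear. -/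
def adjoint [NeZero n] (A : ContinuousMultilinearMap 𝕜 X Z) (B : Set.range A → Y)
    (hB : ∃ C : ℝ≥0, LipschitzWith C B) (hBA : IsMultilinearComp A B) :
    StrongDual 𝕜 Y →L[𝕜] ImageDual A :=
  LinearMap.mkContinuous
    { toFun := fun y => ⟨fun a => y (B a),
        ⟨‖y‖₊ * hB.choose, y.lipschitz.comp hB.choose_spec⟩,
        y.toLinearMap.compMultilinearMap hBA.choose, fun x => by simp [hBA.choose_spec]⟩
      map_add' := fun _ _ => rfl
      map_smul' := fun _ _ => rfl }
    (lipConst B) fun y => by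
      refine lipConst_le (mul_nonneg (lipConst_nonneg _) (norm_nonneg _)) fun a b => ?_
      change dist (y (B a)) (y (B b)) ≤ _
      have h1 := y.lipschitz.dist_le_mul (B a) (B b)
      have h2 := mul_le_mul_of_nonneg_left (dist_le_lipConst hB a b) (norm_nonneg y)
      rw [coe_nnnorm] at h1
      linarith

/-! ### Factorizations -/

/-- `T = B ∘ A` is a factorization through the subset `f_A(Σ) = A(X_1 × ⋯ × X_n)` of the Banach
space `Z`, where `A` is a Lipschitz `p`-summing multilinear operator and `B` is a Lipschitz function
whose adjoint `B^*` is `q`-summing, with `c = π_p^{Lip}(A) π_q(B^*)`. -/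
def FactorsWith [NeZero n] (p q : ℝ≥0∞) (T : MultilinearMap 𝕜 X Y)
    (A : ContinuousMultilinearMap 𝕜 X Z) (B : Set.range A → Y) (c : ℝ) : Prop :=
  IsLipSumming p A ∧ (∀ x, T x = B (toImage A x)) ∧
    ∃ (hB : ∃ C : ℝ≥0, LipschitzWith C B) (hBA : IsMultilinearComp A B),
      IsSumming q (adjoint A B hB hBA) ∧
      c = lipSummingNorm p A * summingNorm q (adjoint A B hB hBA)

end Multilinear

/-- The values `π_p^{Lip}(A) π_q(B^*)` over all factorizations `T = B ∘ A` as in `FactorsWith`. -/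
def factorizationValues {𝕜 : Type} [RCLike 𝕜] {n : ℕ} [NeZero n]
    {X : Fin n → Type u} [∀ i, NormedAddCommGroup (X i)] [∀ i, NormedSpace 𝕜 (X i)]
    {Y : Type u} [NormedAddCommGroup Y] [NormedSpace 𝕜 Y]
    (p q : ℝ≥0∞) (T : MultilinearMap 𝕜 X Y) : Set ℝ :=
  {c | ∃ (Z : Type u) (_ : NormedAddCommGroup Z) (_ : NormedSpace 𝕜 Z) (_ : CompleteSpace Z)
    (A : ContinuousMultilinearMap 𝕜 X Z) (B : Set.range A → Y), FactorsWith p q T A B c}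

end Kwapien

end

/-! All three conditions express one estimate, and each implication preserves the constant; this
gives the equality of the infima.

From (i) to (ii): a weak norm is attained at a point of any weak*-compact norming set
(`IsCompactNorming.exists_weakNorm_le`). For finite p and q, with s = r*, the weighted AM-GM
inequality turns the product into a sum. For every finite family of triples (x, z, y*), the
corresponding sum of the functions C^s ((s/p)|ψ(⊗x - ⊗z)|^p + (s/q)|χ(y*)|^q) - |y*(Tx - Tz)|^s is
then nonnegative somewhere on K × L. The finite sums form a convex cone that misses the open cone of
negative functions. Hahn–Banach separation (`exists_positive_functional`) gives a positive
functional, and its two marginals are the measures μ and ν. Scaling x, z and y* independently turns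
the additive estimate back into a product (`exists_measures_of_sum_le`). If an exponent is ∞, that
variable is normalized instead.

From (ii) to (iii): A sends x to the function ψ ↦ ψ(⊗x) in L_p(μ), or in C(K) if p = ∞, and B sends
Ax to Tx. The domination inequality makes B well defined and Lipschitz, and bounds ‖B*y*‖ by C times
the q-mean of y* (`DominationOn.exists_factorization`).

From (iii) to (i): |y*(Tx - Tz)| ≤ ‖Ax - Az‖ ‖B*y*‖, and Hölder's inequality with 1/p + 1/q = 1/r*
finishes (`dominatedWith_of_factorization`). -/

namespace Kwapien

/-! ### Norms of finite sequences -/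

section EllNorm

variable {F G : Type*} [SeminormedAddCommGroup F] [SeminormedAddCommGroup G] {m : ℕ} {s : ℝ≥0∞}

theorem ellNorm_top (a : Fin m → F) : ellNorm ∞ a = ⨆ i, ‖a i‖ := rfl

theorem toReal_pos_of_one_le (hs : 1 ≤ s) (hs' : s ≠ ∞) : 0 < s.toReal :=
  ENNReal.toReal_pos (zero_lt_one.trans_le hs).ne' hs'

theorem ellNorm_eq_sum (hs : 1 ≤ s) (hs' : s ≠ ∞) (a : Fin m → F) :
    ellNorm s a = (∑ i, ‖a i‖ ^ s.toReal) ^ (1 / s.toReal) :=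
  PiLp.norm_eq_sum (toReal_pos_of_one_le hs hs') _

theorem ellNorm_rpow (hs : 1 ≤ s) (hs' : s ≠ ∞) (a : Fin m → F) :
    ellNorm s a ^ s.toReal = ∑ i, ‖a i‖ ^ s.toReal := by
  rw [ellNorm_eq_sum hs hs', ← Real.rpow_mul (Finset.sum_nonneg fun i _ => by positivity),
    one_div_mul_cancel (toReal_pos_of_one_le hs hs').ne', Real.rpow_one]

theorem ellNorm_nonneg (hs : 1 ≤ s) (a : Fin m → F) : 0 ≤ ellNorm s a := by
  have : Fact (1 ≤ s) := ⟨hs⟩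
  exact norm_nonneg _

theorem ellNorm_mono (hs : 1 ≤ s) {a : Fin m → F} {b : Fin m → G} (h : ∀ i, ‖a i‖ ≤ ‖b i‖) :
    ellNorm s a ≤ ellNorm s b := by
  rcases eq_or_ne s ∞ with rfl | hs'
  · exact ciSup_mono (Set.finite_range _).bddAbove h
  · rw [ellNorm_eq_sum hs hs', ellNorm_eq_sum hs hs']
    have := toReal_pos_of_one_le hs hs'
    gcongr with i
    exact h i

theorem norm_le_ellNorm (hs : 1 ≤ s) (a : Fin m → F) (i : Fin m) : ‖a i‖ ≤ ellNorm s a := by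
  have : Fact (1 ≤ s) := ⟨hs⟩
  exact PiLp.norm_apply_le (WithLp.toLp s a : PiLp s fun _ : Fin m => F) i

theorem ellNorm_top_le {c : ℝ} (hc : 0 ≤ c) {a : Fin m → F} (h : ∀ i, ‖a i‖ ≤ c) :
    ellNorm ∞ a ≤ c := Real.iSup_le h hc

theorem ellNorm_const_mul (hs : 1 ≤ s) {c : ℝ} (hc : 0 ≤ c) (a : Fin m → ℝ) :
    ellNorm s (fun i => c * a i) = c * ellNorm s a := by
  have : Fact (1 ≤ s) := ⟨hs⟩
  have h := norm_smul c (WithLp.toLp s a : PiLp s fun _ : Fin m => ℝ)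
  rwa [Real.norm_of_nonneg hc] at h

theorem ellNorm_single (hs : 1 ≤ s) (a : F) : ellNorm s (fun _ : Fin 1 => a) = ‖a‖ := by
  rcases eq_or_ne s ∞ with rfl | hs'
  · simp [ellNorm_top]
  · rw [ellNorm_eq_sum hs hs']
    simp only [Finset.univ_unique, Finset.sum_const, Finset.card_singleton, one_smul]
    rw [← Real.rpow_mul (norm_nonneg _), mul_one_div_cancel (toReal_pos_of_one_le hs hs').ne',
      Real.rpow_one]

/-- Hölder's inequality for finite sequences. -/
theorem ellNorm_mul_le {p q : ℝ≥0∞} (hp : 1 ≤ p) (hq : 1 ≤ q) (hs : 1 ≤ s)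
    (h : p⁻¹ + q⁻¹ = s⁻¹) (a b : Fin m → ℝ) :
    ellNorm s (fun i => a i * b i) ≤ ellNorm p a * ellNorm q b := by
  rcases eq_or_ne p ∞ with rfl | hp'
  · obtain rfl : q = s := by simpa using h
    rw [← ellNorm_const_mul hq (ellNorm_nonneg hp a)]
    refine ellNorm_mono hq fun i => ?_
    rw [norm_mul, norm_mul, Real.norm_of_nonneg (ellNorm_nonneg hp a)]
    gcongr
    exact norm_le_ellNorm hp a i
  rcases eq_or_ne q ∞ with rfl | hq'
  · obtain rfl : p = s := by simpa using h
    rw [mul_comm, ← ellNorm_const_mul hp (ellNorm_nonneg hq b)]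
    refine ellNorm_mono hp fun i => ?_
    rw [norm_mul, norm_mul, mul_comm, Real.norm_of_nonneg (ellNorm_nonneg hq b)]
    gcongr
    exact norm_le_ellNorm hq b i
  have hs' : s ≠ ∞ := by
    rintro rfl
    simp_all
  have hp0 := toReal_pos_of_one_le hp hp'
  have hq0 := toReal_pos_of_one_le hq hq'
  have hs0 := toReal_pos_of_one_le hs hs'
  have : ENNReal.HolderTriple p q s := ⟨h⟩
  have key := Real.Lr_rpow_le_Lp_mul_Lq Finset.univ a b (ENNReal.HolderTriple.toReal s hp0 hq0)
  have hA : 0 ≤ ∑ i, |a i| ^ p.toReal := Finset.sum_nonneg fun i _ => by positivity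
  have hB : 0 ≤ ∑ i, |b i| ^ q.toReal := Finset.sum_nonneg fun i _ => by positivity
  have key2 := Real.rpow_le_rpow (Finset.sum_nonneg fun i _ => by positivity) key
    (one_div_nonneg.2 hs0.le)
  rw [Real.mul_rpow (by positivity) (by positivity), ← Real.rpow_mul hA, ← Real.rpow_mul hB,
    show s.toReal / p.toReal * (1 / s.toReal) = 1 / p.toReal by field_simp,
    show s.toReal / q.toReal * (1 / s.toReal) = 1 / q.toReal by field_simp] at key2
  rw [ellNorm_eq_sum hs hs', ellNorm_eq_sum hp hp', ellNorm_eq_sum hq hq']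
  simpa only [Real.norm_eq_abs] using key2

end EllNorm

/-! ### Exponents -/

/-- Both sides complete 1/r to 1, and 1/r ≤ 1 is finite and can be cancelled. This is the exponent
relation in Hölder's inequality. -/
theorem rStar_inv {p q : ℝ≥0∞} (hpq : p⁻¹ + q⁻¹ ≤ 1) : p⁻¹ + q⁻¹ = (rStar p q)⁻¹ := by
  have h1 := (rStar_spec p q).inv_add_inv_eq_inv
  have h2 := rExp_spec hpq
  rw [add_assoc] at h2
  rw [inv_one, h2] at h1
  refine (ENNReal.add_right_inj ?_).1 h1.symm
  rw [rExp, inv_inv]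
  exact (tsub_le_self.trans_lt ENNReal.one_lt_top).ne

theorem one_le_rStar (p q : ℝ≥0∞) : 1 ≤ rStar p q := by
  have := (rStar_spec p q).symm
  exact ENNReal.HolderConjugate.one_le (rStar p q) (rExp p q)

theorem rStar_top_left (q : ℝ≥0∞) (hq : 1 ≤ q) : rStar ∞ q = q := by
  have := rStar_inv (p := ∞) (q := q) (by simpa using hq)
  simpa using this.symm

theorem rStar_top_right (p : ℝ≥0∞) (hp : 1 ≤ p) : rStar p ∞ = p := by
  have := rStar_inv (p := p) (q := ∞) (by simpa using hp)
  simpa using this.symm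

/-! ### Weak norms of finite sequences -/

section WeakNorm

variable {𝕜 : Type} [RCLike 𝕜] {E : Type*} [SeminormedAddCommGroup E] [NormedSpace 𝕜 E]
  {s : ℝ≥0∞} {m : ℕ}

theorem norm_apply_le_of_norm_le_one {f : StrongDual 𝕜 E} (hf : ‖f‖ ≤ 1) (v : E) :
    ‖f v‖ ≤ ‖v‖ :=
  (f.le_of_opNorm_le hf v).trans_eq (one_mul _)

theorem bddAbove_weakNorm (hs : 1 ≤ s) (v : Fin m → E) :
    BddAbove (Set.range fun f : {f : StrongDual 𝕜 E // ‖f‖ ≤ 1} => ellNorm s fun i => f.1 (v i)) := by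
  refine ⟨ellNorm s v, ?_⟩
  rintro _ ⟨f, rfl⟩
  exact ellNorm_mono hs fun i => norm_apply_le_of_norm_le_one f.2 _

theorem ellNorm_apply_le_weakNorm (hs : 1 ≤ s) (v : Fin m → E) {f : StrongDual 𝕜 E}
    (hf : ‖f‖ ≤ 1) : ellNorm s (fun i => f (v i)) ≤ weakNorm 𝕜 s v :=
  le_ciSup (bddAbove_weakNorm (𝕜 := 𝕜) hs v) ⟨f, hf⟩

theorem weakNorm_nonneg (hs : 1 ≤ s) (v : Fin m → E) : 0 ≤ weakNorm 𝕜 s v :=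
  Real.iSup_nonneg fun _ => ellNorm_nonneg hs _

theorem weakNorm_single_le (hs : 1 ≤ s) (v : E) : weakNorm 𝕜 s (fun _ : Fin 1 => v) ≤ ‖v‖ :=
  Real.iSup_le (fun f => (ellNorm_single hs _).trans_le (norm_apply_le_of_norm_le_one f.2 v))
    (norm_nonneg v)

theorem weakNorm_top_le {v : Fin m → E} {c : ℝ} (hc : 0 ≤ c) (h : ∀ i, ‖v i‖ ≤ c) :
    weakNorm 𝕜 ∞ v ≤ c :=
  Real.iSup_le (fun f => ellNorm_top_le hc fun i =>
    (norm_apply_le_of_norm_le_one f.2 _).trans (h i)) hc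

/-- A norming functional for the single vector v i already detects its norm in the i-th coordinate.
-/
theorem norm_le_weakNorm (hs : 1 ≤ s) (v : Fin m → E) (i : Fin m) : ‖v i‖ ≤ weakNorm 𝕜 s v := by
  obtain ⟨g, hg, hgv⟩ := exists_dual_vector'' 𝕜 (v i)
  have h1 := norm_le_ellNorm hs (fun j => g (v j)) i
  rw [hgv, RCLike.norm_ofReal, abs_of_nonneg (norm_nonneg _)] at h1
  exact h1.trans (ellNorm_apply_le_weakNorm hs v hg)

theorem continuous_ellNorm_apply (hs : 1 ≤ s) (v : Fin m → E) :
    Continuous fun ψ : WeakDual 𝕜 E => ellNorm s fun i => ψ (v i) := by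
  have : Fact (1 ≤ s) := ⟨hs⟩
  refine continuous_norm.comp ((PiLp.continuous_toLp s _).comp ?_)
  exact continuous_pi fun i => WeakDual.eval_continuous (v i)

theorem IsCompactNorming.nonempty {K : Set (WeakDual 𝕜 E)} (hK : IsCompactNorming K) :
    K.Nonempty := (hK.norming 0).nonempty.of_image

/-- The weak norm of a finite sequence is attained on every weak* compact norming set. -/
theorem IsCompactNorming.exists_weakNorm_le {K : Set (WeakDual 𝕜 E)} (hK : IsCompactNorming K)
    (hs : 1 ≤ s) (v : Fin m → E) : ∃ ψ ∈ K, weakNorm 𝕜 s v ≤ ellNorm s fun i => ψ (v i) := by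
  have : Fact (1 ≤ s) := ⟨hs⟩
  obtain ⟨ψ, hψ, hmax⟩ := hK.isCompact.exists_isMaxOn hK.nonempty
    (continuous_ellNorm_apply hs v).continuousOn
  refine ⟨ψ, hψ, Real.iSup_le (fun f => ?_) (ellNorm_nonneg hs _)⟩
  obtain ⟨g, hg, hga⟩ := exists_dual_vector'' 𝕜
    (WithLp.toLp s (fun i => f.1 (v i)) : PiLp s fun _ : Fin m => 𝕜)
  -- The functional g norms the sequence (f (v i)) in ℓ_s. Its coefficients assemble the v i into
  -- one vector w with g((f (v i))_i) = f(w) for every linear f, so the weak norm is tested on the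
  -- single vector w, where K is norming.
  let w : E := ∑ i, g (WithLp.toLp s (Pi.single i 1)) • v i
  have hw : ∀ f : E →ₗ[𝕜] 𝕜, g (WithLp.toLp s fun i => f (v i)) = f w := by
    intro f
    have : (WithLp.toLp s (fun i => f (v i)) : PiLp s fun _ : Fin m => 𝕜) =
        ∑ i, f (v i) • WithLp.toLp s (Pi.single i (1 : 𝕜)) := by
      ext j
      simp [Pi.single_apply]
    rw [this, map_sum, map_sum]
    exact Finset.sum_congr rfl fun i _ => by simp [mul_comm]
  have h1 : ellNorm s (fun i => f.1 (v i)) = ‖f.1 w‖ := by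
    rw [← f.1.coe_coe, ← hw f.1]
    change ‖_‖ = ‖g (WithLp.toLp s (fun i => f.1 (v i)))‖
    rw [hga, RCLike.norm_ofReal, abs_norm]
    rfl
  rw [h1]
  refine (norm_apply_le_of_norm_le_one f.2 w).trans ?_
  refine (hK.norming w).2 ?_
  rintro _ ⟨χ, hχ, rfl⟩
  refine le_trans ?_ (hmax hχ)
  have h2 := hw (WeakDual.toStrongDual χ).toLinearMap
  change _ = χ w at h2
  simp only [← h2]
  exact (norm_apply_le_of_norm_le_one hg _)

/-- Banach–Alaoglu gives compactness and Hahn–Banach gives the norming property. The balls are the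
concrete K and L used to build factorizations. -/
theorem isCompactNorming_closedBall :
    IsCompactNorming (𝕜 := 𝕜) (E := E)
      (WeakDual.toStrongDual ⁻¹' Metric.closedBall (0 : StrongDual 𝕜 E) 1) where
  isCompact := WeakDual.isCompact_closedBall 0 1
  norm_le_one ψ hψ := by simpa using hψ
  norming u := by
    constructor
    · rintro _ ⟨ψ, hψ, rfl⟩
      exact norm_apply_le_of_norm_le_one (f := WeakDual.toStrongDual ψ) (by simpa using hψ) u
    · intro b hb
      obtain ⟨g, hg, hgu⟩ := exists_dual_vector'' 𝕜 u
      refine le_of_eq_of_le ?_ (hb ⟨StrongDual.toWeakDual g, by simpa using hg, rfl⟩)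
      change _ = ‖g u‖
      rw [hgu, RCLike.norm_ofReal, abs_norm]

end WeakNorm

/-! ### Duality between bounded multilinear forms and the projective tensor product -/

section Segre

variable {𝕜 : Type} [RCLike 𝕜] {n : ℕ}
  {X : Fin n → Type*} [∀ i, NormedAddCommGroup (X i)] [∀ i, NormedSpace 𝕜 (X i)]

/-- The weak norm of a sequence of differences of elementary tensors. -/
theorem segreWeakNorm_eq_weakNorm (s : ℝ≥0∞) {m : ℕ} (x z : Fin m → ∀ i, X i) :
    segreWeakNorm 𝕜 s x z =
      weakNorm 𝕜 s fun j => PiTensorProduct.tprod 𝕜 (x j) - PiTensorProduct.tprod 𝕜 (z j) := by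
  -- Lifting to the tensor product is an isometry, so it matches the unit balls over which the two
  -- suprema run.
  let e : {φ : ContinuousMultilinearMap 𝕜 X 𝕜 // ‖φ‖ ≤ 1} ≃
      {f : StrongDual 𝕜 (⨂[𝕜] i, X i) // ‖f‖ ≤ 1} :=
    (PiTensorProduct.liftIsometry 𝕜 X 𝕜).toEquiv.subtypeEquiv fun φ => by
      change _ ↔ ‖PiTensorProduct.liftIsometry 𝕜 X 𝕜 φ‖ ≤ 1
      rw [LinearIsometryEquiv.norm_map]
  refine e.iSup_congr fun φ => ?_
  congr 1
  ext j
  change PiTensorProduct.liftIsometry 𝕜 X 𝕜 φ.1 _ = _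
  simp

end Segre

/-! ### Positive functionals and Pietsch measures -/

section Positive

variable {S : Type*} [TopologicalSpace S] [CompactSpace S]

/-- A Ky Fan type lemma: if `t` is a convex set of continuous functions containing `0`, each of which
has a nonnegative value, then some normalized positive functional is nonnegative on `t`. -/
theorem exists_positive_functional [Nonempty S] {t : Set C(S, ℝ)} (ht : Convex ℝ t) (h0 : 0 ∈ t)
    (h : ∀ f ∈ t, ∃ x, 0 ≤ f x) :
    ∃ Λ : C(S, ℝ) →ₗ[ℝ] ℝ, (∀ f, (∀ x, 0 ≤ f x) → 0 ≤ Λ f) ∧ Λ 1 = 1 ∧ ∀ f ∈ t, 0 ≤ Λ f := by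
  let N : Set C(S, ℝ) := {f | ∀ x, f x < 0}
  have hN : Convex ℝ N := by
    intro f hf g hg a b ha hb hab x
    have h1 := hf x
    have h2 := hg x
    change a * f x + b * g x < 0
    rcases ha.eq_or_lt with rfl | ha
    · have : b = 1 := by linarith
      subst this
      linarith
    · nlinarith [mul_nonneg hb (neg_nonneg.2 h2.le), mul_pos ha (neg_pos.2 h1)]
  have hNo : IsOpen N := by
    have := ContinuousMap.isOpen_setOfPred_mapsTo (X := S) (Y := ℝ) isCompact_univ (isOpen_Iio (a := 0))
    simpa [Set.MapsTo, N] using this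
  have hdisj : Disjoint N t := by
    rw [Set.disjoint_left]
    intro f hf hft
    obtain ⟨x, hx⟩ := h f hft
    exact absurd (hf x) (not_lt.2 hx)
  obtain ⟨Λ, u, hΛN, hΛt⟩ := geometric_hahn_banach_open hN hNo ht hdisj
  -- The separating level u is 0: testing 0 ∈ t gives u ≤ 0, and testing negative constants of
  -- arbitrarily small size gives u ≥ 0.
  have hu : u ≤ 0 := by simpa using hΛt 0 h0
  have hneg : ∀ f ∈ N, Λ f ≤ 0 := fun f hf => (hΛN f hf).le.trans hu
  have hone : 0 < Λ 1 := by
    have : Λ (-1) < u := hΛN (-1) fun x => by simp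
    rw [map_neg] at this
    linarith
  have hu' : 0 ≤ u := by
    refine le_of_forall_pos_le_add fun ε hε => ?_
    have : Λ (-((ε / Λ 1) • (1 : C(S, ℝ)))) < u := hΛN _ fun x => by
      simpa using div_pos hε hone
    rw [map_neg, map_smul, smul_eq_mul, div_mul_cancel₀ _ hone.ne'] at this
    linarith
  refine ⟨(Λ 1)⁻¹ • Λ.toLinearMap, fun f hf => ?_, by simp [hone.ne'], fun f hf => ?_⟩
  · refine mul_nonneg (inv_nonneg.2 hone.le) ?_
    refine le_of_forall_pos_le_add fun ε hε => ?_
    -- The function -f is only nonpositive; subtracting a positive constant moves it into `N`, at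
    -- the cost of ε.
    have : Λ (-f - (ε / Λ 1) • (1 : C(S, ℝ))) ≤ 0 := hneg _ fun x => by
      have := hf x
      have := div_pos hε hone
      simp
      linarith
    rw [map_sub, map_neg, map_smul, smul_eq_mul, div_mul_cancel₀ _ hone.ne'] at this
    change 0 ≤ Λ f + ε
    linarith
  · exact mul_nonneg (inv_nonneg.2 hone.le) (hu'.trans (hΛt f hf))

/-- The Ky Fan lemma for a family of functions that is stable under positive scaling. -/
theorem exists_positive_functional_of_family [Nonempty S] {I : Type*} (f : I → C(S, ℝ))
    (hsmul : ∀ i, ∀ t : ℝ, 0 < t → ∃ j, f j = t • f i)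
    (h : ∀ (m : ℕ) (i : Fin m → I), ∃ x, 0 ≤ ∑ k, f (i k) x) :
    ∃ Λ : C(S, ℝ) →ₗ[ℝ] ℝ, (∀ f, (∀ x, 0 ≤ f x) → 0 ≤ Λ f) ∧ Λ 1 = 1 ∧ ∀ i, 0 ≤ Λ (f i) := by
  -- Finite sums, with the empty sum providing 0; stability of the family under scaling makes this
  -- set a convex cone.
  let t : Set C(S, ℝ) := {g | ∃ (m : ℕ) (i : Fin m → I), g = ∑ k, f (i k)}
  have hts : ∀ g ∈ t, ∀ c : ℝ, 0 ≤ c → c • g ∈ t := by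
    rintro _ ⟨m, i, rfl⟩ c hc
    rcases hc.eq_or_lt with rfl | hc
    · exact ⟨0, Fin.elim0, by simp⟩
    · choose j hj using fun k => hsmul (i k) c hc
      exact ⟨m, j, by simp [hj, Finset.smul_sum]⟩
  have hta : ∀ g ∈ t, ∀ h ∈ t, g + h ∈ t := by
    rintro _ ⟨m, i, rfl⟩ _ ⟨m', i', rfl⟩
    exact ⟨m + m', Fin.append i i', by simp [Fin.sum_univ_add]⟩
  obtain ⟨Λ, h1, h2, h3⟩ := exists_positive_functional (S := S) (t := t)
    (fun g hg k hk a b ha hb _ => hta _ (hts g hg a ha) _ (hts k hk b hb))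
    ⟨0, Fin.elim0, by simp⟩ (by
      rintro _ ⟨m, i, rfl⟩
      simpa using h m i)
  exact ⟨Λ, h1, h2, fun i => h3 _ ⟨1, fun _ => i, by simp⟩⟩

/-- The Riesz representation of a normalized positive functional on `C(S, ℝ)`. -/
theorem exists_regular_probability [T2Space S] [MeasurableSpace S] [BorelSpace S]
    (Λ : C(S, ℝ) →ₗ[ℝ] ℝ) (hΛ : ∀ f, (∀ x, 0 ≤ f x) → 0 ≤ Λ f) (h1 : Λ 1 = 1) :
    ∃ μ : Measure S, IsProbabilityMeasure μ ∧ μ.Regular ∧ ∀ f : C(S, ℝ), ∫ x, f x ∂μ = Λ f := by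
  let Φ : CompactlySupportedContinuousMap S ℝ →ₚ[ℝ] ℝ :=
    { toFun := fun g => Λ g.toContinuousMap
      map_add' := fun f g => Λ.map_add f.toContinuousMap g.toContinuousMap
      map_smul' := fun c g => Λ.map_smul c g.toContinuousMap
      monotone' := fun f g hfg => by
        have h := hΛ (g.toContinuousMap - f.toContinuousMap) fun x => sub_nonneg.2 (hfg x)
        rw [map_sub] at h
        exact sub_nonneg.1 h }
  -- On a compact space every continuous function has compact support, so the Riesz–Markov theorem
  -- covers all of C(S, ℝ). Testing it on 1 gives total mass 1.
  have key : ∀ f : C(S, ℝ), ∫ x, f x ∂(RealRMK.rieszMeasure Φ) = Λ f := fun f =>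
    RealRMK.integral_rieszMeasure Φ (CompactlySupportedContinuousMap.continuousMapEquiv f)
  refine ⟨RealRMK.rieszMeasure Φ, ⟨?_⟩, inferInstance, key⟩
  have h := key 1
  rw [h1] at h
  simp only [ContinuousMap.one_apply, integral_const, smul_eq_mul, mul_one] at h
  rw [Measure.real, ENNReal.toReal_eq_one_iff] at h
  exact h

end Positive

/-! ### Dominating measures from inequalities for finite families -/

section Pietsch

variable {I : Type*} {K L : Type*} [TopologicalSpace K] [CompactSpace K] [T2Space K]
  [MeasurableSpace K] [BorelSpace K] [TopologicalSpace L] [CompactSpace L] [T2Space L]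
  [MeasurableSpace L] [BorelSpace L]

/-- `|f|^s` as a continuous function. -/
noncomputable def powMap {S : Type*} [TopologicalSpace S] (f : C(S, ℝ)) {s : ℝ} (hs : 0 ≤ s) : C(S, ℝ) :=
  ⟨fun x => |f x| ^ s, (continuous_abs.comp f.continuous).rpow_const fun _ => Or.inr hs⟩

/-- One-sided Pietsch domination. -/
theorem exists_measure_of_sum_le [Nonempty L] {q : ℝ} (hq : 0 < q) {C : ℝ} (hC : 0 < C)
    (a : I → ℝ) (G : I → C(L, ℝ)) (ha : ∀ i, 0 ≤ a i)
    (hsmul : ∀ i, ∀ t : ℝ, 0 < t → ∃ j, a j = t * a i ∧ G j = t • G i)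
    (h : ∀ (m : ℕ) (i : Fin m → I), ∃ l, ∑ k, a (i k) ^ q ≤ C ^ q * ∑ k, |G (i k) l| ^ q) :
    ∃ ν : Measure L, IsProbabilityMeasure ν ∧ ν.Regular ∧
      ∀ i, a i ≤ C * (∫ l, |G i l| ^ q ∂ν) ^ (1 / q) := by
  obtain ⟨Λ, hΛ, hΛ1, hΛf⟩ := exists_positive_functional_of_family
    (fun i => C ^ q • powMap (G i) hq.le - a i ^ q • (1 : C(L, ℝ)))
    (fun i t ht => by
      -- The test function is homogeneous of degree q in the index, so scaling it by t amounts to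
      -- scaling the index by t^(1/q).
      obtain ⟨j, hja, hjG⟩ := hsmul i (t ^ (1 / q)) (by positivity)
      have htq : (t ^ (1 / q)) ^ q = t := by
        rw [← Real.rpow_mul ht.le, one_div_mul_cancel hq.ne', Real.rpow_one]
      refine ⟨j, ?_⟩
      ext l
      simp only [powMap, hja, hjG, ContinuousMap.sub_apply, ContinuousMap.smul_apply,
        ContinuousMap.coe_mk, smul_eq_mul, ContinuousMap.one_apply]
      rw [abs_mul, abs_of_pos (show 0 < t ^ (1 / q) by positivity),
        Real.mul_rpow (by positivity) (by positivity), Real.mul_rpow (by positivity) (ha i), htq]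
      ring)
    (fun m i => by
      obtain ⟨l, hl⟩ := h m i
      refine ⟨l, ?_⟩
      simp only [powMap, ContinuousMap.sub_apply, ContinuousMap.smul_apply,
        ContinuousMap.coe_mk, smul_eq_mul, ContinuousMap.one_apply, mul_one,
        Finset.sum_sub_distrib, ← Finset.mul_sum]
      linarith)
  obtain ⟨ν, hν, hν', hνΛ⟩ := exists_regular_probability Λ hΛ hΛ1
  refine ⟨ν, hν, hν', fun i => ?_⟩
  have h1 := hΛf i
  rw [map_sub, map_smul, map_smul, hΛ1, ← hνΛ] at h1
  simp only [powMap, ContinuousMap.coe_mk, smul_eq_mul, mul_one, sub_nonneg] at h1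
  have hint : 0 ≤ ∫ l, |G i l| ^ q ∂ν := integral_nonneg fun l => by positivity
  have h2 := Real.rpow_le_rpow (Real.rpow_nonneg (ha i) q) h1 (one_div_nonneg.2 hq.le)
  rwa [Real.mul_rpow (by positivity) hint, ← Real.rpow_mul (ha i), ← Real.rpow_mul hC.le,
    mul_one_div_cancel hq.ne', Real.rpow_one, Real.rpow_one] at h2

/-- Two-sided Pietsch domination. -/
theorem exists_measures_of_sum_le [Nonempty K] [Nonempty L] {p q s : ℝ}
    (hpq : p.HolderTriple q s) {C : ℝ} (hC : 0 < C)
    (a : I → ℝ) (F : I → C(K, ℝ)) (G : I → C(L, ℝ)) (ha : ∀ i, 0 ≤ a i)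
    (hsmul : ∀ i, ∀ t τ : ℝ, 0 < t → 0 < τ →
      ∃ j, a j = t * τ * a i ∧ F j = t • F i ∧ G j = τ • G i)
    (h : ∀ (m : ℕ) (i : Fin m → I), ∃ k l, (∑ j, a (i j) ^ s) ^ (1 / s) ≤
      C * (∑ j, |F (i j) k| ^ p) ^ (1 / p) * (∑ j, |G (i j) l| ^ q) ^ (1 / q)) :
    ∃ (μ : Measure K) (ν : Measure L), IsProbabilityMeasure μ ∧ μ.Regular ∧
      IsProbabilityMeasure ν ∧ ν.Regular ∧
      ∀ i, a i ≤ C * (∫ k, |F i k| ^ p ∂μ) ^ (1 / p) * (∫ l, |G i l| ^ q ∂ν) ^ (1 / q) := by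
  have hp := hpq.pos
  have hq := hpq.symm.pos
  have hs := hpq.pos'
  have hw : s / p + s / q = 1 := by
    have := hpq.inv_add_inv_eq_inv
    rw [div_eq_mul_inv, div_eq_mul_inv, ← mul_add, this, mul_inv_cancel₀ hs.ne']
  let fK : C(K × L, K) := ⟨Prod.fst, continuous_fst⟩
  let fL : C(K × L, L) := ⟨Prod.snd, continuous_snd⟩
  obtain ⟨Λ, hΛ, hΛ1, hΛf⟩ := exists_positive_functional_of_family (S := K × L)
    (fun i => C ^ s • ((s / p) • (powMap (F i) hp.le).comp fK +
      (s / q) • (powMap (G i) hq.le).comp fL) - a i ^ s • (1 : C(K × L, ℝ)))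
    (fun i t ht => by
      obtain ⟨j, hja, hjF, hjG⟩ := hsmul i (t ^ (1 / p)) (t ^ (1 / q)) (by positivity)
        (by positivity)
      have htp : (t ^ (1 / p)) ^ p = t := by
        rw [← Real.rpow_mul ht.le, one_div_mul_cancel hp.ne', Real.rpow_one]
      have htq : (t ^ (1 / q)) ^ q = t := by
        rw [← Real.rpow_mul ht.le, one_div_mul_cancel hq.ne', Real.rpow_one]
      have hts : (t ^ (1 / p) * t ^ (1 / q)) ^ s = t := by
        rw [← Real.rpow_add ht, ← Real.rpow_mul ht.le,
          show (1 / p + 1 / q) * s = s / p + s / q by ring, hw, Real.rpow_one]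
      refine ⟨j, ?_⟩
      ext l
      simp only [powMap, hja, hjF, hjG, ContinuousMap.sub_apply, ContinuousMap.smul_apply,
        ContinuousMap.add_apply, ContinuousMap.comp_apply,
        ContinuousMap.coe_mk, smul_eq_mul, ContinuousMap.one_apply]
      rw [abs_mul, abs_mul, abs_of_pos (show 0 < t ^ (1 / q) by positivity),
        abs_of_pos (show 0 < t ^ (1 / p) by positivity),
        Real.mul_rpow (by positivity) (by positivity),
        Real.mul_rpow (x := t ^ (1 / q)) (by positivity) (by positivity),
        Real.mul_rpow (z := s) (by positivity) (ha i), htp, htq, hts]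
      ring)
    (fun m i => by
      obtain ⟨k, l, hl⟩ := h m i
      refine ⟨(k, l), ?_⟩
      simp only [powMap, ContinuousMap.sub_apply, ContinuousMap.smul_apply, fK, fL,
        ContinuousMap.add_apply, ContinuousMap.comp_apply,
        ContinuousMap.coe_mk, smul_eq_mul, ContinuousMap.one_apply, mul_one,
        Finset.sum_sub_distrib, ← Finset.mul_sum, Finset.sum_add_distrib, sub_nonneg]
      have hA : 0 ≤ ∑ j, |F (i j) k| ^ p := Finset.sum_nonneg fun i _ => by positivity
      have hB : 0 ≤ ∑ j, |G (i j) l| ^ q := Finset.sum_nonneg fun i _ => by positivity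
      have hS : 0 ≤ ∑ j, a (i j) ^ s := Finset.sum_nonneg fun j _ => Real.rpow_nonneg (ha _) _
      have h1 := Real.rpow_le_rpow (Real.rpow_nonneg hS _) hl hs.le
      rw [← Real.rpow_mul hS, one_div_mul_cancel hs.ne', Real.rpow_one,
        Real.mul_rpow (by positivity) (by positivity), Real.mul_rpow hC.le (by positivity),
        ← Real.rpow_mul hA, ← Real.rpow_mul hB, one_div_mul_eq_div, one_div_mul_eq_div,
        mul_assoc] at h1
      refine h1.trans ?_
      gcongr
      -- The weights s/p and s/q sum to 1. Weighted AM-GM replaces the product of sums by a sum over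
      -- j, the additive form that the Ky Fan lemma needs.
      exact Real.geom_mean_le_arith_mean2_weighted (by positivity) (by positivity) hA hB hw)
  -- Each test function is a sum of a function on K and a function on L, so only the two marginals
  -- of `Λ` matter.
  obtain ⟨μ, hμ, hμ', hμΛ⟩ := exists_regular_probability
    { toFun := fun g : C(K, ℝ) => Λ (g.comp fK)
      map_add' := fun f g => Λ.map_add (f.comp fK) (g.comp fK)
      map_smul' := fun c g => Λ.map_smul c (g.comp fK) }
    (fun f hf => hΛ _ fun x => hf _) hΛ1
  obtain ⟨ν, hν, hν', hνΛ⟩ := exists_regular_probability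
    { toFun := fun g : C(L, ℝ) => Λ (g.comp fL)
      map_add' := fun f g => Λ.map_add (f.comp fL) (g.comp fL)
      map_smul' := fun c g => Λ.map_smul c (g.comp fL) }
    (fun f hf => hΛ _ fun x => hf _) hΛ1
  refine ⟨μ, ν, hμ, hμ', hν, hν', fun i => ?_⟩
  have key : ∀ i, a i ^ s ≤ C ^ s *
      (s / p * ∫ k, |F i k| ^ p ∂μ + s / q * ∫ l, |G i l| ^ q ∂ν) := by
    intro i
    have h1 := hΛf i
    rw [map_sub, map_smul, map_smul, hΛ1, map_add, map_smul, map_smul] at h1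
    have h2 := hμΛ (powMap (F i) hp.le)
    have h3 := hνΛ (powMap (G i) hq.le)
    simp only [powMap, ContinuousMap.coe_mk, LinearMap.coe_mk, AddHom.coe_mk] at h2 h3
    simp only [powMap, smul_eq_mul, mul_one, sub_nonneg] at h1
    rw [h2, h3]
    exact h1
  set P := (∫ k, |F i k| ^ p ∂μ) with hPdef
  set Q := (∫ l, |G i l| ^ q ∂ν) with hQdef
  have hP : 0 ≤ P := integral_nonneg fun l => by positivity
  have hQ : 0 ≤ Q := integral_nonneg fun l => by positivity
  -- Dividing the two variables by t and τ makes both integrals at most 1, so the additive estimate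
  -- yields a j ≤ C; undoing the scaling gives the product. The ε keeps t and τ positive when an
  -- integral vanishes.
  have main : ∀ ε > 0, a i ≤ C * (P ^ (1 / p) + ε) * (Q ^ (1 / q) + ε) := by
    intro ε hε
    set t := P ^ (1 / p) + ε with ht
    set τ := Q ^ (1 / q) + ε with hτ
    have ht0 : 0 < t := by positivity
    have hτ0 : 0 < τ := by positivity
    obtain ⟨j, hja, hjF, hjG⟩ := hsmul i t⁻¹ τ⁻¹ (by positivity) (by positivity)
    have hkey := key j
    have hPt : (t ^ p)⁻¹ * P ≤ 1 := by
      rw [inv_mul_le_one₀ (by positivity)]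
      calc P = (P ^ (1 / p)) ^ p := by
            rw [← Real.rpow_mul hP, one_div_mul_cancel hp.ne', Real.rpow_one]
        _ ≤ t ^ p := by gcongr; linarith
    have hQt : (τ ^ q)⁻¹ * Q ≤ 1 := by
      rw [inv_mul_le_one₀ (by positivity)]
      calc Q = (Q ^ (1 / q)) ^ q := by
            rw [← Real.rpow_mul hQ, one_div_mul_cancel hq.ne', Real.rpow_one]
        _ ≤ τ ^ q := by gcongr; linarith
    have e1 : ∫ k, |F j k| ^ p ∂μ = (t ^ p)⁻¹ * P := by
      rw [hPdef, ← integral_const_mul]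
      congr 1
      ext k
      rw [hjF, ContinuousMap.smul_apply, smul_eq_mul, abs_mul, abs_of_pos (inv_pos.2 ht0),
        Real.mul_rpow (by positivity) (by positivity), Real.inv_rpow ht0.le]
    have e2 : ∫ k, |G j k| ^ q ∂ν = (τ ^ q)⁻¹ * Q := by
      rw [hQdef, ← integral_const_mul]
      congr 1
      ext k
      rw [hjG, ContinuousMap.smul_apply, smul_eq_mul, abs_mul, abs_of_pos (inv_pos.2 hτ0),
        Real.mul_rpow (by positivity) (by positivity), Real.inv_rpow hτ0.le]
    rw [e1, e2] at hkey
    have h1 : a j ^ s ≤ C ^ s := by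
      refine hkey.trans (mul_le_of_le_one_right (by positivity) ?_)
      calc s / p * ((t ^ p)⁻¹ * P) + s / q * ((τ ^ q)⁻¹ * Q) ≤ s / p * 1 + s / q * 1 := by gcongr
        _ = 1 := by rw [mul_one, mul_one, hw]
    have h2 : a j ≤ C := (Real.rpow_le_rpow_iff (ha j) hC.le hs).1 h1
    rw [hja] at h2
    calc a i = (t⁻¹ * τ⁻¹ * a i) * (t * τ) := by field_simp
      _ ≤ C * (t * τ) := by gcongr
      _ = _ := by ring
  have hlim : Filter.Tendsto (fun ε : ℝ => C * (P ^ (1 / p) + ε) * (Q ^ (1 / q) + ε))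
      (nhdsWithin 0 (Set.Ioi 0)) (nhds (C * (P ^ (1 / p) + 0) * (Q ^ (1 / q) + 0))) :=
    (Continuous.tendsto (by fun_prop) 0).mono_left nhdsWithin_le_nhds
  rw [add_zero, add_zero] at hlim
  exact ge_of_tendsto hlim (Filter.eventually_of_mem self_mem_nhdsWithin main)

end Pietsch

/-! ### Means over weak* compact sets -/

section Mean

variable {𝕜 : Type} [RCLike 𝕜] {E : Type*} [SeminormedAddCommGroup E] [NormedSpace 𝕜 E]
  {s : ℝ≥0∞} {K : Set (WeakDual 𝕜 E)} (μ : Measure K)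

theorem dualMean_nonneg (u : E) : 0 ≤ dualMean s μ u := by
  unfold dualMean
  split_ifs
  · exact norm_nonneg _
  · exact Real.rpow_nonneg (integral_nonneg fun ψ => by positivity) _

theorem dualMean_top (u : E) : dualMean ∞ μ u = ‖u‖ := if_pos rfl

theorem dualMean_of_ne_top (hs : s ≠ ∞) (u : E) :
    dualMean s μ u = (∫ ψ : K, ‖ψ.1 u‖ ^ s.toReal ∂μ) ^ (1 / s.toReal) := if_neg hs

theorem dualMean_rpow (hs : 1 ≤ s) (hs' : s ≠ ∞) (u : E) :
    dualMean s μ u ^ s.toReal = ∫ ψ : K, ‖ψ.1 u‖ ^ s.toReal ∂μ := by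
  rw [dualMean_of_ne_top μ hs', ← Real.rpow_mul (integral_nonneg fun ψ => by positivity),
    one_div_mul_cancel (toReal_pos_of_one_le hs hs').ne', Real.rpow_one]

theorem continuous_eval_subtype (u : E) : Continuous fun ψ : K => ψ.1 u :=
  (WeakDual.eval_continuous u).comp continuous_subtype_val

variable [IsProbabilityMeasure μ]

/-- The weak norm dominates the `ℓ_s`-norm of the means. -/
theorem ellNorm_dualMean_le_weakNorm (hK : IsCompactNorming K) (hs : 1 ≤ s) {m : ℕ}
    (v : Fin m → E) : ellNorm s (fun j => dualMean s μ (v j)) ≤ weakNorm 𝕜 s v := by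
  rcases eq_or_ne s ∞ with rfl | hs'
  · refine ellNorm_top_le (weakNorm_nonneg hs v) fun j => ?_
    rw [dualMean_top, norm_norm]
    exact norm_le_weakNorm hs v j
  have hs0 := toReal_pos_of_one_le hs hs'
  have : CompactSpace K := isCompact_iff_compactSpace.1 hK.isCompact
  rw [← Real.rpow_le_rpow_iff (ellNorm_nonneg hs _) (weakNorm_nonneg hs v) hs0,
    ellNorm_rpow hs hs']
  have hc : ∀ j, Continuous fun ψ : K => ‖ψ.1 (v j)‖ ^ s.toReal := fun j =>
    (continuous_eval_subtype (v j)).norm.rpow_const fun _ => Or.inr hs0.le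
  have hint : ∀ f : K → ℝ, Continuous f → Integrable f μ := fun f hf =>
    integrableOn_univ.1 (hf.continuousOn.integrableOn_compact isCompact_univ)
  calc ∑ j, ‖dualMean s μ (v j)‖ ^ s.toReal = ∑ j, ∫ ψ : K, ‖ψ.1 (v j)‖ ^ s.toReal ∂μ := by
        refine Finset.sum_congr rfl fun j _ => ?_
        rw [Real.norm_of_nonneg (dualMean_nonneg μ _), dualMean_rpow μ hs hs']
    _ = ∫ ψ : K, ∑ j, ‖ψ.1 (v j)‖ ^ s.toReal ∂μ :=
        (integral_finsetSum _ fun j _ => hint _ (hc j)).symm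
    -- Every ψ in K lies in the unit ball, so the bound holds pointwise; μ has mass 1.
    _ ≤ ∫ _ψ : K, weakNorm 𝕜 s v ^ s.toReal ∂μ := by
        refine integral_mono (hint _ (continuous_finsetSum _ fun j _ => hc j))
          (integrable_const _) fun ψ => ?_
        change ∑ j, ‖ψ.1 (v j)‖ ^ s.toReal ≤ _
        rw [← ellNorm_rpow hs hs' fun j => ψ.1 (v j)]
        refine Real.rpow_le_rpow (ellNorm_nonneg hs _) ?_ hs0.le
        exact ellNorm_apply_le_weakNorm hs v (f := WeakDual.toStrongDual ψ.1)
          (hK.norm_le_one _ ψ.2)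
    _ = weakNorm 𝕜 s v ^ s.toReal := by simp

theorem dualMean_le_norm (hK : IsCompactNorming K) (hs : 1 ≤ s) (u : E) :
    dualMean s μ u ≤ ‖u‖ := by
  have h1 := (ellNorm_dualMean_le_weakNorm μ hK hs fun _ : Fin 1 => u).trans
    (weakNorm_single_le hs u)
  rwa [ellNorm_single hs, Real.norm_of_nonneg (dualMean_nonneg μ u)] at h1

end Mean

/-! ### Domination and Pietsch-type domination -/

section Domination

variable {𝕜 : Type} [RCLike 𝕜] {n : ℕ}
  {X : Fin n → Type*} [∀ i, NormedAddCommGroup (X i)] [∀ i, NormedSpace 𝕜 (X i)]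
  {Y : Type*} [NormedAddCommGroup Y] [NormedSpace 𝕜 Y]
  {p q : ℝ≥0∞} {T : MultilinearMap 𝕜 X Y}
  {K : Set (WeakDual 𝕜 (⨂[𝕜] i, X i))} {L : Set (WeakDual 𝕜 (StrongDual 𝕜 Y))} {C : ℝ}

/-- A bound of `|⟨y^*, T x - T z⟩|` by a product implies domination, by Hölder's inequality. -/
theorem dominatedWith_of_le_mul (hp : 1 ≤ p) (hq : 1 ≤ q) (hpq : p⁻¹ + q⁻¹ ≤ 1)
    {α : (∀ i, X i) → (∀ i, X i) → ℝ} {β : StrongDual 𝕜 Y → ℝ} {C₁ C₂ : ℝ} (h₁ : 0 ≤ C₁)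
    (h : ∀ x z y, ‖y (T x - T z)‖ ≤ α x z * β y)
    (hα : ∀ (m : ℕ) (x z : Fin m → ∀ i, X i),
      ellNorm p (fun j => α (x j) (z j)) ≤ C₁ * segreWeakNorm 𝕜 p x z)
    (hβ : ∀ (m : ℕ) (y : Fin m → StrongDual 𝕜 Y),
      ellNorm q (fun j => β (y j)) ≤ C₂ * weakNorm 𝕜 q y) :
    DominatedWith p q T (C₁ * C₂) := by
  intro m x z y
  have hr := one_le_rStar p q
  calc ellNorm (rStar p q) (fun j => y j (T (x j) - T (z j)))
      ≤ ellNorm (rStar p q) (fun j => α (x j) (z j) * β (y j)) :=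
        ellNorm_mono hr fun j => (h _ _ _).trans (le_abs_self _)
    _ ≤ ellNorm p (fun j => α (x j) (z j)) * ellNorm q (fun j => β (y j)) :=
        ellNorm_mul_le hp hq hr (rStar_inv hpq) _ _
    _ ≤ (C₁ * segreWeakNorm 𝕜 p x z) * (C₂ * weakNorm 𝕜 q y) := by
        refine mul_le_mul (hα m x z) (hβ m y) (ellNorm_nonneg hq _) (mul_nonneg h₁ ?_)
        rw [segreWeakNorm_eq_weakNorm]
        exact weakNorm_nonneg hp _
    _ = _ := by ring

theorem DominationOn.dominatedWith (hp : 1 ≤ p) (hq : 1 ≤ q) (hpq : p⁻¹ + q⁻¹ ≤ 1)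
    (hK : IsCompactNorming K) (hL : IsCompactNorming L) (hC : 0 < C)
    (h : DominationOn p q T K L C) : DominatedWith p q T C := by
  obtain ⟨μ, ν, _, _, _, _, h⟩ := h
  rw [← mul_one C]
  refine dominatedWith_of_le_mul hp hq hpq hC.le h (fun m x z => ?_) fun m y => ?_
  · rw [ellNorm_const_mul hp hC.le, segreWeakNorm_eq_weakNorm]
    gcongr
    exact ellNorm_dualMean_le_weakNorm μ hK hp _
  · rw [one_mul]
    exact ellNorm_dualMean_le_weakNorm ν hL hq y

/-- This is the case of sequences of length one. It settles p = q = ∞, and it handles tensor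
differences of projective norm 0, which cannot be normalized. -/
theorem DominatedWith.norm_apply_le (hp : 1 ≤ p) (hq : 1 ≤ q) (hC : 0 ≤ C)
    (h : DominatedWith p q T C) (x z : ∀ i, X i) (y : StrongDual 𝕜 Y) :
    ‖y (T x - T z)‖ ≤ C * ‖PiTensorProduct.tprod 𝕜 x - PiTensorProduct.tprod 𝕜 z‖ * ‖y‖ := by
  have h1 := h 1 (fun _ => x) (fun _ => z) fun _ => y
  rw [ellNorm_single (one_le_rStar p q), segreWeakNorm_eq_weakNorm] at h1
  refine h1.trans ?_
  gcongr
  · exact weakNorm_nonneg hq _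
  · exact weakNorm_single_le hp _
  · exact weakNorm_single_le hq _

/-- Scaling one coordinate scales a multilinear expression. Differences of elementary tensors are
not closed under addition, but this homogeneity is all that the Ky Fan argument requires. -/
theorem exists_smul_tprod_sub [NeZero n] (T : MultilinearMap 𝕜 X Y) (x z : ∀ i, X i) (t : 𝕜) :
    ∃ x' z' : ∀ i, X i, T x' - T z' = t • (T x - T z) ∧
      PiTensorProduct.tprod 𝕜 x' - PiTensorProduct.tprod 𝕜 z' =
        t • (PiTensorProduct.tprod 𝕜 x - PiTensorProduct.tprod 𝕜 z) := by
  refine ⟨Function.update x 0 (t • x 0), Function.update z 0 (t • z 0), ?_, ?_⟩ <;>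
    simp only [MultilinearMap.map_update_smul, Function.update_eq_self, smul_sub]

/-- A point evaluation is represented by a regular probability measure. It serves as a placeholder
on a side with exponent ∞, where the measure does not enter the inequality. -/
theorem exists_regular_probability_of_nonempty {S : Type*} [TopologicalSpace S] [CompactSpace S]
    [T2Space S] [MeasurableSpace S] [BorelSpace S] (h : Nonempty S) :
    ∃ μ : Measure S, IsProbabilityMeasure μ ∧ μ.Regular := by
  obtain ⟨μ, h1, h2, -⟩ := exists_regular_probability
    (ContinuousMap.evalCLM ℝ h.some : C(S, ℝ) →L[ℝ] ℝ).toLinearMap (fun f hf => hf _) rfl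
  exact ⟨μ, h1, h2⟩

/-- Attaining both weak norms replaces the suprema by single points of K and L, the input of the
two-sided Pietsch argument. -/
theorem DominatedWith.exists_le (hp : 1 ≤ p) (hq : 1 ≤ q) (hK : IsCompactNorming K)
    (hL : IsCompactNorming L) (hC : 0 ≤ C) (h : DominatedWith p q T C) {m : ℕ}
    (x z : Fin m → ∀ i, X i) (y : Fin m → StrongDual 𝕜 Y) :
    ∃ (ψ : K) (χ : L), ellNorm (rStar p q) (fun j => y j (T (x j) - T (z j))) ≤
      C * ellNorm p (fun j => ψ.1 (PiTensorProduct.tprod 𝕜 (x j) - PiTensorProduct.tprod 𝕜 (z j))) *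
        ellNorm q (fun j => χ.1 (y j)) := by
  obtain ⟨ψ, hψ, h1⟩ := hK.exists_weakNorm_le hp
    fun j => PiTensorProduct.tprod 𝕜 (x j) - PiTensorProduct.tprod 𝕜 (z j)
  obtain ⟨χ, hχ, h2⟩ := hL.exists_weakNorm_le hq y
  refine ⟨⟨ψ, hψ⟩, ⟨χ, hχ⟩, (h m x z y).trans ?_⟩
  rw [segreWeakNorm_eq_weakNorm]
  have := weakNorm_nonneg (𝕜 := 𝕜) hq y
  have := ellNorm_nonneg hp fun j =>
    ψ (PiTensorProduct.tprod 𝕜 (x j) - PiTensorProduct.tprod 𝕜 (z j))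
  gcongr

/-- The continuous function `ψ ↦ |ψ u|` on a set of functionals. -/
noncomputable def absEval {E : Type*} [SeminormedAddCommGroup E] [NormedSpace 𝕜 E]
    (K : Set (WeakDual 𝕜 E)) (u : E) : C(K, ℝ) :=
  ⟨fun ψ => ‖ψ.1 u‖, (continuous_eval_subtype u).norm⟩

theorem abs_absEval {E : Type*} [SeminormedAddCommGroup E] [NormedSpace 𝕜 E]
    (K : Set (WeakDual 𝕜 E)) (u : E) (ψ : K) : |absEval K u ψ| = ‖ψ.1 u‖ :=
  abs_norm (ψ.1 u)

theorem absEval_smul {E : Type*} [SeminormedAddCommGroup E] [NormedSpace 𝕜 E]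
    (K : Set (WeakDual 𝕜 E)) {t : ℝ} (ht : 0 < t) (u : E) :
    absEval K ((t : 𝕜) • u) = t • absEval K u := by
  ext ψ
  change ‖ψ.1 ((t : 𝕜) • u)‖ = t * ‖ψ.1 u‖
  rw [map_smul, norm_smul, RCLike.norm_ofReal, abs_of_pos ht]

theorem DominatedWith.dominationOn_of_ne_top [NeZero n] (hp : 1 ≤ p) (hq : 1 ≤ q)
    (hpq : p⁻¹ + q⁻¹ ≤ 1) (hp' : p ≠ ∞) (hq' : q ≠ ∞) (hK : IsCompactNorming K)
    (hL : IsCompactNorming L) (hC : 0 < C) (h : DominatedWith p q T C) :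
    DominationOn p q T K L C := by
  have : CompactSpace K := isCompact_iff_compactSpace.1 hK.isCompact
  have : CompactSpace L := isCompact_iff_compactSpace.1 hL.isCompact
  have : Nonempty K := hK.nonempty.to_subtype
  have : Nonempty L := hL.nonempty.to_subtype
  have hs := one_le_rStar p q
  have hinv := rStar_inv hpq
  have hs' : rStar p q ≠ ∞ := by
    intro h
    simp_all
  have : ENNReal.HolderTriple p q (rStar p q) := ⟨hinv⟩
  obtain ⟨μ, ν, h1, h2, h3, h4, h5⟩ := exists_measures_of_sum_le
    (I := (∀ i, X i) × (∀ i, X i) × StrongDual 𝕜 Y)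
    (ENNReal.HolderTriple.toReal (rStar p q) (toReal_pos_of_one_le hp hp')
      (toReal_pos_of_one_le hq hq')) hC
    (fun i => ‖i.2.2 (T i.1 - T i.2.1)‖)
    (fun i => absEval K (PiTensorProduct.tprod 𝕜 i.1 - PiTensorProduct.tprod 𝕜 i.2.1))
    (fun i => absEval L i.2.2) (fun i => norm_nonneg _)
    (by
      rintro ⟨x, z, y⟩ t τ ht hτ
      obtain ⟨x', z', hT, ht'⟩ := exists_smul_tprod_sub T x z (t : 𝕜)
      refine ⟨(x', z', (τ : 𝕜) • y), ?_, ?_, absEval_smul L hτ y⟩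
      · simp only [hT, map_smul, smul_apply, RCLike.norm_ofReal,
          abs_of_pos ht, abs_of_pos hτ, smul_eq_mul, norm_mul]
        ring
      · simp only [ht', absEval_smul K ht])
    (fun m i => by
      obtain ⟨ψ, χ, hle⟩ := h.exists_le hp hq hK hL hC.le (fun j => (i j).1) (fun j => (i j).2.1)
        fun j => (i j).2.2
      refine ⟨ψ, χ, ?_⟩
      rw [ellNorm_eq_sum hs hs', ellNorm_eq_sum hp hp', ellNorm_eq_sum hq hq'] at hle
      simpa only [abs_absEval] using hle)
  refine ⟨μ, ν, h1, h2, h3, h4, fun x z y => ?_⟩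
  simpa only [abs_absEval, dualMean_of_ne_top _ hp', dualMean_of_ne_top _ hq'] using h5 (x, z, y)

/-- Here r* = q. Restricting to tensor differences of norm at most 1 makes their weak ∞-norm at most
1, leaving a one-sided problem in y*; homogeneity then recovers all other differences. -/
theorem DominatedWith.dominationOn_top_left [NeZero n] (hq : 1 ≤ q) (hq' : q ≠ ∞)
    (hK : IsCompactNorming K) (hL : IsCompactNorming L) (hC : 0 < C)
    (h : DominatedWith ∞ q T C) : DominationOn ∞ q T K L C := by
  have : CompactSpace K := isCompact_iff_compactSpace.1 hK.isCompact
  have : CompactSpace L := isCompact_iff_compactSpace.1 hL.isCompact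
  have : Nonempty L := hL.nonempty.to_subtype
  obtain ⟨μ, hμ, hμ'⟩ := exists_regular_probability_of_nonempty hK.nonempty.to_subtype
  obtain ⟨ν, h3, h4, h5⟩ := exists_measure_of_sum_le
    (I := {i : (∀ i, X i) × (∀ i, X i) × StrongDual 𝕜 Y //
      ‖PiTensorProduct.tprod 𝕜 i.1 - PiTensorProduct.tprod 𝕜 i.2.1‖ ≤ 1})
    (toReal_pos_of_one_le hq hq') hC
    (fun i => ‖i.1.2.2 (T i.1.1 - T i.1.2.1)‖)
    (fun i => absEval L i.1.2.2) (fun i => norm_nonneg _)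
    (by
      rintro ⟨⟨x, z, y⟩, hi⟩ τ hτ
      refine ⟨⟨(x, z, (τ : 𝕜) • y), hi⟩, ?_, absEval_smul L hτ y⟩
      simp only [norm_smul, smul_apply, RCLike.norm_ofReal, abs_of_pos hτ])
    (fun m i => by
      obtain ⟨χ, hχ, hle⟩ := hL.exists_weakNorm_le hq fun j => (i j).1.2.2
      refine ⟨⟨χ, hχ⟩, ?_⟩
      have h1 := h m (fun j => (i j).1.1) (fun j => (i j).1.2.1) fun j => (i j).1.2.2
      rw [rStar_top_left q hq, segreWeakNorm_eq_weakNorm] at h1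
      have h2 := weakNorm_top_le (𝕜 := 𝕜) zero_le_one fun j => (i j).2
      have h3 := h1.trans (mul_le_mul (mul_le_of_le_one_right hC.le h2) hle
        (weakNorm_nonneg hq _) hC.le)
      have h4 := Real.rpow_le_rpow (ellNorm_nonneg hq _) h3 (toReal_pos_of_one_le hq hq').le
      rw [Real.mul_rpow hC.le (ellNorm_nonneg hq _), ellNorm_rpow hq hq', ellNorm_rpow hq hq'] at h4
      simpa only [abs_absEval] using h4)
  refine ⟨μ, ν, hμ, hμ', h3, h4, fun x z y => ?_⟩
  rw [dualMean_top]
  set u := PiTensorProduct.tprod 𝕜 x - PiTensorProduct.tprod 𝕜 z with hu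
  rcases (norm_nonneg u).eq_or_lt with h0 | h0
  · have h6 := h.norm_apply_le le_top hq hC.le x z y
    rw [← hu, ← h0, mul_zero, zero_mul] at h6
    rw [← h0, mul_zero, zero_mul]
    exact h6
  · obtain ⟨x', z', hT, ht'⟩ := exists_smul_tprod_sub T x z ((‖u‖⁻¹ : ℝ) : 𝕜)
    have h6 := h5 ⟨(x', z', y), by
      simp only [ht', norm_smul, RCLike.norm_ofReal, abs_inv, abs_norm]
      exact (inv_mul_cancel₀ h0.ne').le⟩
    simp only [hT, map_smul, norm_smul, RCLike.norm_ofReal, abs_inv, abs_norm, abs_absEval] at h6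
    rw [← dualMean_of_ne_top ν hq', inv_mul_le_iff₀ h0] at h6
    linarith

/-- Here r* = p, and the functionals y* are restricted to the unit ball, leaving a one-sided problem
in the tensor differences. -/
theorem DominatedWith.dominationOn_top_right [NeZero n] (hp : 1 ≤ p) (hp' : p ≠ ∞)
    (hK : IsCompactNorming K) (hL : IsCompactNorming L) (hC : 0 < C)
    (h : DominatedWith p ∞ T C) : DominationOn p ∞ T K L C := by
  have : CompactSpace K := isCompact_iff_compactSpace.1 hK.isCompact
  have : CompactSpace L := isCompact_iff_compactSpace.1 hL.isCompact
  have : Nonempty K := hK.nonempty.to_subtype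
  obtain ⟨ν, hν, hν'⟩ := exists_regular_probability_of_nonempty hL.nonempty.to_subtype
  obtain ⟨μ, h3, h4, h5⟩ := exists_measure_of_sum_le
    (I := {i : (∀ i, X i) × (∀ i, X i) × StrongDual 𝕜 Y // ‖i.2.2‖ ≤ 1})
    (toReal_pos_of_one_le hp hp') hC
    (fun i => ‖i.1.2.2 (T i.1.1 - T i.1.2.1)‖)
    (fun i => absEval K (PiTensorProduct.tprod 𝕜 i.1.1 - PiTensorProduct.tprod 𝕜 i.1.2.1))
    (fun i => norm_nonneg _)
    (by
      rintro ⟨⟨x, z, y⟩, hi⟩ t ht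
      obtain ⟨x', z', hT, ht'⟩ := exists_smul_tprod_sub T x z (t : 𝕜)
      refine ⟨⟨(x', z', y), hi⟩, ?_, ?_⟩
      · simp only [hT, map_smul, norm_smul, RCLike.norm_ofReal, abs_of_pos ht]
      · simp only [ht', absEval_smul K ht])
    (fun m i => by
      obtain ⟨ψ, hψ, hle⟩ := hK.exists_weakNorm_le hp fun j =>
        PiTensorProduct.tprod 𝕜 (i j).1.1 - PiTensorProduct.tprod 𝕜 (i j).1.2.1
      refine ⟨⟨ψ, hψ⟩, ?_⟩
      have h1 := h m (fun j => (i j).1.1) (fun j => (i j).1.2.1) fun j => (i j).1.2.2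
      rw [rStar_top_right p hp, segreWeakNorm_eq_weakNorm] at h1
      have h2 := weakNorm_top_le (𝕜 := 𝕜) zero_le_one fun j => (i j).2
      have h3 := h1.trans (mul_le_of_le_one_right
        (mul_nonneg hC.le (weakNorm_nonneg hp _)) h2) |>.trans (mul_le_mul_of_nonneg_left hle hC.le)
      have h4 := Real.rpow_le_rpow (ellNorm_nonneg hp _) h3 (toReal_pos_of_one_le hp hp').le
      rw [Real.mul_rpow hC.le (ellNorm_nonneg hp _), ellNorm_rpow hp hp', ellNorm_rpow hp hp'] at h4
      simpa only [abs_absEval] using h4)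
  refine ⟨μ, ν, h3, h4, hν, hν', fun x z y => ?_⟩
  rw [dualMean_top]
  rcases (norm_nonneg y).eq_or_lt with h0 | h0
  · have h6 := y.le_opNorm (T x - T z)
    rw [← h0, zero_mul] at h6
    rwa [← h0, mul_zero]
  · have h6 := h5 ⟨(x, z, ((‖y‖⁻¹ : ℝ) : 𝕜) • y), by
      simp only [norm_smul, RCLike.norm_ofReal, abs_inv, abs_norm]
      exact (inv_mul_cancel₀ h0.ne').le⟩
    simp only [smul_apply, norm_smul, RCLike.norm_ofReal, abs_inv, abs_norm,
      abs_absEval] at h6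
    rw [← dualMean_of_ne_top μ hp', inv_mul_le_iff₀ h0] at h6
    linarith

theorem DominatedWith.dominationOn [NeZero n] (hp : 1 ≤ p) (hq : 1 ≤ q)
    (hpq : p⁻¹ + q⁻¹ ≤ 1) (hK : IsCompactNorming K) (hL : IsCompactNorming L) (hC : 0 < C)
    (h : DominatedWith p q T C) : DominationOn p q T K L C := by
  by_cases hp' : p = ∞ <;> by_cases hq' : q = ∞
  · subst hp' hq'
    have : CompactSpace K := isCompact_iff_compactSpace.1 hK.isCompact
    have : CompactSpace L := isCompact_iff_compactSpace.1 hL.isCompact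
    obtain ⟨μ, hμ, hμ'⟩ := exists_regular_probability_of_nonempty hK.nonempty.to_subtype
    obtain ⟨ν, hν, hν'⟩ := exists_regular_probability_of_nonempty hL.nonempty.to_subtype
    refine ⟨μ, ν, hμ, hμ', hν, hν', fun x z y => ?_⟩
    rw [dualMean_top, dualMean_top]
    exact h.norm_apply_le le_top le_top hC.le x z y
  · subst hp'
    exact h.dominationOn_top_left hq hq' hK hL hC
  · subst hq'
    exact h.dominationOn_top_right hp hp' hK hL hC
  · exact h.dominationOn_of_ne_top hp hq hpq hp' hq' hK hL hC

end Domination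

/-! ### Factorizations -/

/-- The means over a weak* compact set are the norms of the images in a Banach space. -/
theorem exists_norm_eq_dualMean {𝕜 : Type} [RCLike 𝕜] {E : Type u} [SeminormedAddCommGroup E]
    [NormedSpace 𝕜 E] {K : Set (WeakDual 𝕜 E)} (hK : IsCompactNorming K) {s : ℝ≥0∞} (hs : 1 ≤ s)
    (μ : Measure K) [IsProbabilityMeasure μ] :
    ∃ (Z : Type u) (_ : NormedAddCommGroup Z) (_ : NormedSpace 𝕜 Z) (_ : CompleteSpace Z)
      (j : E →ₗ[𝕜] Z), ∀ u, ‖j u‖ = dualMean s μ u := by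
  have : CompactSpace K := isCompact_iff_compactSpace.1 hK.isCompact
  have : Nonempty K := hK.nonempty.to_subtype
  have : Fact (1 ≤ s) := ⟨hs⟩
  let ev : E →ₗ[𝕜] C(K, 𝕜) :=
    { toFun := fun u => ⟨fun ψ => ψ.1 u, continuous_eval_subtype u⟩
      map_add' := fun u v => by ext ψ; exact map_add ψ.1 u v
      map_smul' := fun c u => by ext ψ; exact map_smul ψ.1 c u }
  rcases eq_or_ne s ∞ with rfl | hs'
  -- Since K is norming, the sup norm of the evaluation function on K is ‖u‖. For finite s the same
  -- function is taken in L_s(μ).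
  · refine ⟨C(K, 𝕜), inferInstance, inferInstance, inferInstance, ev, fun u => ?_⟩
    rw [dualMean_top]
    refine le_antisymm ((ContinuousMap.norm_le _ (norm_nonneg u)).2 fun ψ => ?_) ?_
    · exact norm_apply_le_of_norm_le_one (f := WeakDual.toStrongDual ψ.1)
        (hK.norm_le_one _ ψ.2) u
    · refine (hK.norming u).2 ?_
      rintro _ ⟨ψ, hψ, rfl⟩
      exact (ev u).norm_coe_le_norm ⟨ψ, hψ⟩
  · refine ⟨Lp 𝕜 s μ, inferInstance, inferInstance, inferInstance,
      (ContinuousMap.toLp s μ 𝕜 : C(K, 𝕜) →L[𝕜] Lp 𝕜 s μ).toLinearMap ∘ₗ ev, fun u => ?_⟩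
    have hs0 := toReal_pos_of_one_le hs hs'
    change ‖ContinuousMap.toLp s μ 𝕜 (ev u)‖ = _
    rw [Lp.norm_def, eLpNorm_congr_ae (ContinuousMap.coeFn_toLp μ (ev u)),
      dualMean_of_ne_top μ hs']
    have hmem : MemLp (ev u) s μ :=
      (memLp_congr_ae (ContinuousMap.coeFn_toLp μ (𝕜 := 𝕜) (ev u))).1 (Lp.memLp _)
    rw [hmem.eLpNorm_eq_integral_rpow_norm (zero_lt_one.trans_le hs).ne' hs',
      ENNReal.toReal_ofReal (by positivity), one_div]
    rfl

/-! ### From a factorization to domination -/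

section

variable {𝕜 : Type} [RCLike 𝕜] {n : ℕ} [NeZero n]
  {X : Fin n → Type*} [∀ i, NormedAddCommGroup (X i)] [∀ i, NormedSpace 𝕜 (X i)]
  {Y : Type*} [NormedAddCommGroup Y] [NormedSpace 𝕜 Y]
  {Z : Type*} [NormedAddCommGroup Z] [NormedSpace 𝕜 Z]
  {p q : ℝ≥0∞} {T : MultilinearMap 𝕜 X Y} {A : ContinuousMultilinearMap 𝕜 X Z}

theorem adjoint_apply_apply {B : Set.range A → Y} (hB : ∃ C : ℝ≥0, LipschitzWith C B)
    (hBA : IsMultilinearComp A B) (y : StrongDual 𝕜 Y) (a : Set.range A) :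
    (adjoint A B hB hBA y).1 a = y (B a) := rfl

/-- If `T = B ∘ A`, then `C₁ C₂` is a domination constant for all summing constants `C₁` of `A` and
`C₂` of `B^*`. -/
theorem dominatedWith_of_factorization (hp : 1 ≤ p) (hq : 1 ≤ q) (hpq : p⁻¹ + q⁻¹ ≤ 1)
    {B : Set.range A → Y} (hB : ∃ C : ℝ≥0, LipschitzWith C B) (hBA : IsMultilinearComp A B)
    (hT : ∀ x, T x = B (toImage A x)) {C₁ C₂ : ℝ} (h₁ : 0 ≤ C₁) (hA : LipSummingWith p A C₁)
    (hB' : SummingWith q (adjoint A B hB hBA) C₂) : DominatedWith p q T (C₁ * C₂) := by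
  refine dominatedWith_of_le_mul hp hq hpq h₁ (α := fun x z => ‖A x - A z‖)
    (β := fun y => ‖adjoint A B hB hBA y‖) (fun x z y => ?_) (fun m x z => ?_) fun m y => ?_
  · have h := dist_le_lipConst (adjoint A B hB hBA y).2.1 (toImage A x) (toImage A z)
    rw [adjoint_apply_apply, adjoint_apply_apply, dist_eq_norm, ← map_sub, ← hT, ← hT,
      ← imageDual_norm_def, mul_comm] at h
    rwa [Subtype.dist_eq, dist_eq_norm] at h
  · exact (ellNorm_mono hp fun j => (norm_norm _).le).trans (hA m x z)
  · exact (ellNorm_mono hq fun j => (norm_norm _).le).trans (hB' m y)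

/-- The summing norms are infima over positive constants and may be 0, so they need not be
admissible themselves. Admissible constants within ε of them still have product below c'. -/
theorem FactorsWith.exists_dominatedWith (hp : 1 ≤ p) (hq : 1 ≤ q) (hpq : p⁻¹ + q⁻¹ ≤ 1)
    {B : Set.range A → Y} {c : ℝ} (h : FactorsWith p q T A B c) {c' : ℝ} (hc : c < c') :
    ∃ C, 0 < C ∧ C < c' ∧ DominatedWith p q T C := by
  obtain ⟨⟨C₁, hA⟩, hT, hB, hBA, ⟨C₂, hB'⟩, rfl⟩ := h
  have hlim : Filter.Tendsto (fun ε : ℝ => (lipSummingNorm p A + ε) *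
      (summingNorm q (adjoint A B hB hBA) + ε)) (nhdsWithin 0 (Set.Ioi 0))
      (nhds ((lipSummingNorm p A + 0) * (summingNorm q (adjoint A B hB hBA) + 0))) :=
    (Continuous.tendsto (by fun_prop) 0).mono_left nhdsWithin_le_nhds
  rw [add_zero, add_zero] at hlim
  obtain ⟨ε, hε, hε0⟩ := ((hlim.eventually_lt_const hc).and self_mem_nhdsWithin).exists
  obtain ⟨D₁, ⟨hD₁, hD₁A⟩, hD₁ε⟩ := exists_lt_of_csInf_lt (s := {C | 0 < C ∧ LipSummingWith p A C})
    ⟨C₁, hA⟩ (lt_add_of_pos_right _ hε0)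
  obtain ⟨D₂, ⟨hD₂, hD₂B⟩, hD₂ε⟩ := exists_lt_of_csInf_lt
    (s := {C | 0 < C ∧ SummingWith q (adjoint A B hB hBA) C}) ⟨C₂, hB'⟩
    (lt_add_of_pos_right _ hε0)
  refine ⟨D₁ * D₂, mul_pos hD₁ hD₂, lt_trans ?_ hε,
    dominatedWith_of_factorization hp hq hpq hB hBA hT hD₁.le hD₁A hD₂B⟩
  exact mul_lt_mul'' hD₁ε hD₂ε hD₁.le hD₂.le

end

/-! ### From Pietsch-type domination to a factorization -/

section

variable {𝕜 : Type} [RCLike 𝕜] {n : ℕ} [NeZero n]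
  {X : Fin n → Type u} [∀ i, NormedAddCommGroup (X i)] [∀ i, NormedSpace 𝕜 (X i)]
  {Y : Type u} [NormedAddCommGroup Y] [NormedSpace 𝕜 Y]
  {p q : ℝ≥0∞} {T : MultilinearMap 𝕜 X Y}

/-- Pietsch-type domination with constant `C` yields a factorization of value at most `C`. -/
theorem DominationOn.exists_factorization (hp : 1 ≤ p) (hq : 1 ≤ q)
    {K : Set (WeakDual 𝕜 (⨂[𝕜] i, X i))} {L : Set (WeakDual 𝕜 (StrongDual 𝕜 Y))}
    (hK : IsCompactNorming K) (hL : IsCompactNorming L) {C : ℝ} (hC : 0 < C)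
    (h : DominationOn p q T K L C) : ∃ c ∈ factorizationValues p q T, c ≤ C := by
  obtain ⟨μ, ν, _, _, _, _, h⟩ := h
  obtain ⟨Z, _, _, _, j, hj⟩ := exists_norm_eq_dualMean hK hp μ
  let A : ContinuousMultilinearMap 𝕜 X Z :=
    (j.compMultilinearMap (PiTensorProduct.tprod 𝕜)).mkContinuous 1 fun x => by
      rw [one_mul]
      exact ((hj _).trans_le (dualMean_le_norm μ hK hp _)).trans
        (PiTensorProduct.projectiveSeminorm_tprod_le x)
  have hAsub : ∀ x z, ‖A x - A z‖ =
      dualMean p μ (PiTensorProduct.tprod 𝕜 x - PiTensorProduct.tprod 𝕜 z) := fun x z => by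
    rw [← hj, map_sub]
    rfl
  -- A norming functional y for Tx - Tz has q-mean at most ‖y‖ ≤ 1, so the second factor drops out.
  have hTA : ∀ x z, ‖T x - T z‖ ≤ C * ‖A x - A z‖ := fun x z => by
    obtain ⟨y, hy, hyT⟩ := exists_dual_vector'' 𝕜 (T x - T z)
    have h1 := h x z y
    rw [hyT, RCLike.norm_ofReal, abs_norm, ← hAsub] at h1
    exact h1.trans (mul_le_of_le_one_right (by positivity)
      ((dualMean_le_norm ν hL hq y).trans hy))
  -- The choice of preimage is harmless: by `hTA`, Ax = Az forces Tx = Tz.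
  let B : Set.range A → Y := fun a => T a.2.choose
  have hT : ∀ x, T x = B (toImage A x) := fun x => by
    have h1 : A (toImage A x).2.choose = A x := (toImage A x).2.choose_spec
    have h2 := hTA x (toImage A x).2.choose
    rw [h1, sub_self, norm_zero, mul_zero] at h2
    exact sub_eq_zero.1 (norm_le_zero_iff.1 h2)
  have hsurj : ∀ a : Set.range A, ∃ x, a = toImage A x := by
    rintro ⟨_, x, rfl⟩
    exact ⟨x, rfl⟩
  have hB : ∃ C : ℝ≥0, LipschitzWith C B := by
    refine ⟨⟨C, hC.le⟩, LipschitzWith.of_dist_le_mul fun a b => ?_⟩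
    obtain ⟨x, rfl⟩ := hsurj a
    obtain ⟨z, rfl⟩ := hsurj b
    rw [← hT, ← hT, dist_eq_norm, Subtype.dist_eq, dist_eq_norm]
    exact hTA x z
  have hBA : IsMultilinearComp A B := ⟨T, hT⟩
  -- Read for fixed y*, the domination inequality is a Lipschitz estimate for y* ∘ B; its constant
  -- is C times the q-mean, which makes B* q-summing with constant C.
  have hadj : ∀ y, ‖adjoint A B hB hBA y‖ ≤ C * dualMean q ν y := fun y => by
    refine lipConst_le (mul_nonneg hC.le (dualMean_nonneg ν y)) fun a b => ?_
    obtain ⟨x, rfl⟩ := hsurj a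
    obtain ⟨z, rfl⟩ := hsurj b
    rw [adjoint_apply_apply, adjoint_apply_apply, ← hT, ← hT, dist_eq_norm, ← map_sub,
      Subtype.dist_eq, dist_eq_norm]
    refine (h x z y).trans_eq ?_
    rw [← hAsub, mul_right_comm]
    rfl
  have hAsum : LipSummingWith p A 1 := fun m x z => by
    rw [one_mul, segreWeakNorm_eq_weakNorm]
    refine le_trans (ellNorm_mono hp fun i => ?_) (ellNorm_dualMean_le_weakNorm μ hK hp _)
    rw [hAsub]
    exact le_abs_self _
  have hBsum : SummingWith q (adjoint A B hB hBA) C := fun m y => by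
    refine (ellNorm_mono hq (b := fun i => C * dualMean q ν (y i)) fun i =>
      (hadj _).trans (le_abs_self _)).trans ?_
    rw [ellNorm_const_mul hq hC.le]
    exact mul_le_mul_of_nonneg_left (ellNorm_dualMean_le_weakNorm ν hL hq y) hC.le
  refine ⟨_, ⟨Z, _, _, ‹_›, A, B, ⟨1, one_pos, hAsum⟩, hT, hB, hBA, ⟨C, hC, hBsum⟩, rfl⟩, ?_⟩
  have h1 : lipSummingNorm p A ≤ 1 := csInf_le ⟨0, fun _ h => h.1.le⟩ ⟨one_pos, hAsum⟩
  have h2 : summingNorm q (adjoint A B hB hBA) ≤ C :=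
    csInf_le ⟨0, fun _ h => h.1.le⟩ ⟨hC, hBsum⟩
  have h3 : 0 ≤ summingNorm q (adjoint A B hB hBA) := Real.sInf_nonneg fun _ h => h.1.le
  exact (mul_le_mul h1 h2 h3 zero_le_one).trans_eq (one_mul C)

end

end Kwapien

/-! ### The equivalences and the equality of the constants -/

theorem mainTheorem1 {𝕜 : Type} [RCLike 𝕜] {n : ℕ} [NeZero n]
    {X : Fin n → Type u} [∀ i, NormedAddCommGroup (X i)] [∀ i, NormedSpace 𝕜 (X i)]
    [∀ i, CompleteSpace (X i)]
    {Y : Type u} [NormedAddCommGroup Y] [NormedSpace 𝕜 Y] [CompleteSpace Y]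
    (p q : ℝ≥0∞) (hp : 1 ≤ p) (hq : 1 ≤ q) (hpq : p⁻¹ + q⁻¹ ≤ 1)
    (T : MultilinearMap 𝕜 X Y) :
    List.TFAE
      [Kwapien.IsDominated p q T,
        ∀ (K : Set (WeakDual 𝕜 (⨂[𝕜] i, X i))) (L : Set (WeakDual 𝕜 (StrongDual 𝕜 Y))),
          Kwapien.IsCompactNorming K → Kwapien.IsCompactNorming L →
            ∃ C : ℝ, 0 < C ∧ Kwapien.DominationOn p q T K L C,
        (Kwapien.factorizationValues p q T).Nonempty] ∧
    (Kwapien.IsDominated p q T →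
      (∀ (K : Set (WeakDual 𝕜 (⨂[𝕜] i, X i))) (L : Set (WeakDual 𝕜 (StrongDual 𝕜 Y))),
        Kwapien.IsCompactNorming K → Kwapien.IsCompactNorming L →
          IsGLB {C : ℝ | 0 < C ∧ Kwapien.DominationOn p q T K L C}
            (Kwapien.dominatedNorm p q T)) ∧
      IsGLB (Kwapien.factorizationValues p q T) (Kwapien.dominatedNorm p q T)) := by
  have hbdd : BddBelow {C : ℝ | 0 < C ∧ Kwapien.DominatedWith p q T C} := ⟨0, fun _ h => h.1.le⟩
  have hball₁ := Kwapien.isCompactNorming_closedBall (𝕜 := 𝕜) (E := ⨂[𝕜] i, X i)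
  have hball₂ := Kwapien.isCompactNorming_closedBall (𝕜 := 𝕜) (E := StrongDual 𝕜 Y)
  refine ⟨?_, fun hT => ⟨fun K L hK hL => ?_, fun c hc => ?_, fun b hb => ?_⟩⟩
  · tfae_have 1 → 2 := fun ⟨C, hC, h⟩ K L hK hL => ⟨C, hC, h.dominationOn hp hq hpq hK hL hC⟩
    tfae_have 2 → 3 := fun h => by
      obtain ⟨C, hC, h⟩ := h _ _ hball₁ hball₂
      obtain ⟨c, hc, -⟩ := h.exists_factorization hp hq hball₁ hball₂ hC
      exact ⟨c, hc⟩
    tfae_have 3 → 1 := by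
      rintro ⟨c, Z, _, _, _, A, B, h⟩
      obtain ⟨C, hC, -, hCT⟩ := h.exists_dominatedWith hp hq hpq (lt_add_one c)
      exact ⟨C, hC, hCT⟩
    tfae_finish
  -- Both directions preserve the constant, so the two sets of admissible constants, and not only
  -- their infima, coincide.
  · have : {C : ℝ | 0 < C ∧ Kwapien.DominationOn p q T K L C} =
        {C : ℝ | 0 < C ∧ Kwapien.DominatedWith p q T C} :=
      Set.ext fun C => ⟨fun h => ⟨h.1, h.2.dominatedWith hp hq hpq hK hL h.1⟩,
        fun h => ⟨h.1, h.2.dominationOn hp hq hpq hK hL h.1⟩⟩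
    rw [this]
    exact isGLB_csInf hT hbdd
  · obtain ⟨Z, _, _, _, A, B, h⟩ := hc
    -- The value c itself need not be a domination constant, but below every c' > c there is one.
    refine le_of_forall_gt_imp_ge_of_dense fun c' hc' => ?_
    obtain ⟨C, hC, hCc, hCT⟩ := h.exists_dominatedWith hp hq hpq hc'
    exact (csInf_le hbdd ⟨hC, hCT⟩).trans hCc.le
  · refine le_csInf hT fun C hC => ?_
    obtain ⟨c, hc, hcC⟩ := (hC.2.dominationOn hp hq hpq hball₁ hball₂ hC.1).exists_factorization
      hp hq hball₁ hball₂ hC.1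
    exact (hb hc).trans hcC
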